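/- Let $n\ge 0$ and work with real $n\times n$ matrices. Let $B$ and $B_-$ be the groups of invertible upper and lower triangular matrices, $N\subset B$ and $N_-\subset B_-$ the subgroups of unipotent ones, $H$ the group of invertible diagonal matrices, and $G_0=N_-HN$; for $x\in G_0$ write $x=[x]_-[x]_0[x]_+$ for its unique factorization with $[x]_-\in N_-$, $[x]_0\in H$, $[x]_+\in N$. Identify $w\in\mathcal S_n$ with the permutation matrix sending $e_j$ to $e_{w(j)}$, and let $\le$ be the Bruhat order: $u\le v$ iff $B_-uB_-\subset\overline{B_-vB_-}$. Put $N(w)=w^{-1}Bw\cap N$ and $N_-(w)=w^{-1}Bw\cap N_-$. Let $Y$ be the monoid of totally nonnegative elements of $N$, generated by the matrices $x_i(t)$, $t\ge 0$, $1\le i\le n-1$, where $x_i(t)$ differs from the identity only by the entry $t$ in position $(i,i+1)$. Put $Y^\circ_w=Y\cap B_-wB_-$ and $Y_{\ge u}=\bigcup_{v\ge u}Y^\circ_v$. Fix $u\in\mathcal S_n$ and $x_u\in Y^\circ_u$. Let $\pi_u\colon Y_{\ge u}\to Y^\circ_u$ be the projection $\pi_u(x)=[u[u^{-1}[xu^{-1}]_+u]_-]_+$.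 For $x\in Y_{\ge u}$ let $\rho_{x_u}(x)=[xm]_+$, where $m$ is the unique element of $N_-(u)$ such that $xm\in G_0$ and $[xm]_+\in x_uN(u)$. For $\tau>0$ let $d(\tau)=\tau^{-(n-1)/2}\,\mathrm{diag}(\tau^{n-1},\tau^{n-2},\dots,1)$, and for $x\in\pi_u^{-1}(x_u)$ let $$\psi(x)=\frac{d}{d\tau}\,\rho_{x_u}\bigl(d(\tau)\,x\,d(\tau)^{-1}\bigr)\Big|_{\tau=1}.$$ Let $\mathrm{str}(x)=\sum_{i=1}^{n-1}x_{i,i+1}$. Then $\psi$ is well defined on the fiber $\pi_u^{-1}(x_u)$ (for $x$ in the fiber and $\tau>0$ one has $d(\tau)xd(\tau)^{-1}\in Y_{\ge u}$, the element $m$ for it exists and is unique, and the derivative exists); the point $x_u$ lies in the fiber, and it is the only point of the fiber at which $\psi$ vanishes; and the directional derivative $\nabla_\psi\,\mathrm{str}(x)$ is positive at every point $x\ne x_u$ of $\pi_u^{-1}(x_u)$. -/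

import Mathlib

noncomputable section

namespace TNNLink

/-- Real `n × n` matrices. All groups below are sets of such matrices. -/
abbrev Mat (n : ℕ) : Type := Matrix (Fin n) (Fin n) ℝ

/-! ### Triangular subgroups, permutation matrices and the Bruhat decomposition of `GL(n, ℝ)` -/

/-- `B`: invertible upper triangular matrices. -/
def B (n : ℕ) : Set (Mat n) :=
  {b | (∀ i j, j < i → b i j = 0) ∧ ∀ i, b i i ≠ 0}

/-- `B₋`: invertible lower triangular matrices. -/
def Bminus (n : ℕ) : Set (Mat n) :=
  {b | (∀ i j, i < j → b i j = 0) ∧ ∀ i, b i i ≠ 0}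

/-- `N`: unipotent upper triangular matrices. -/
def N (n : ℕ) : Set (Mat n) :=
  {b | (∀ i j, j < i → b i j = 0) ∧ ∀ i, b i i = 1}

/-- `N₋`: unipotent lower triangular matrices. -/
def Nminus (n : ℕ) : Set (Mat n) :=
  {b | (∀ i j, i < j → b i j = 0) ∧ ∀ i, b i i = 1}

/-- `H`: invertible diagonal matrices. -/
def H (n : ℕ) : Set (Mat n) :=
  {h | (∀ i j, i ≠ j → h i j = 0) ∧ ∀ i, h i i ≠ 0}

/-- The permutation matrix of `w`, sending the basis vector `e_j` to `e_{w(j)}`: its entry `(i, j)`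
is `1` if `i = w j` and `0` otherwise. (Mathlib's `permMatrix` uses the inverse convention.) Thus
`perm (u * w) = perm u * perm w`, and `perm w⁻¹` is the inverse matrix of `perm w`. -/
def perm {n : ℕ} (w : Equiv.Perm (Fin n)) : Mat n :=
  (w⁻¹).permMatrix ℝ

/-- The Bruhat cell `B₋ w B₋`. -/
def bruhatCell {n : ℕ} (w : Equiv.Perm (Fin n)) : Set (Mat n) :=
  {x | ∃ b ∈ Bminus n, ∃ b' ∈ Bminus n, x = b * perm w * b'}

/-- The Bruhat order, defined geometrically: `u ≤ v` iff `B₋ u B₋` is contained in the closure of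
`B₋ v B₋`. -/
def bruhatLE {n : ℕ} (u v : Equiv.Perm (Fin n)) : Prop :=
  bruhatCell u ⊆ closure (bruhatCell v)

/-- `N₋(w) = w⁻¹ B w ∩ N₋`. -/
def NminusOf {n : ℕ} (w : Equiv.Perm (Fin n)) : Set (Mat n) :=
  {z | perm w * z * perm w⁻¹ ∈ B n} ∩ Nminus n

/-- `N(w) = w⁻¹ B w ∩ N`. -/
def NOf {n : ℕ} (w : Equiv.Perm (Fin n)) : Set (Mat n) :=
  {z | perm w * z * perm w⁻¹ ∈ B n} ∩ N n

/-! ### Gaussian decomposition -/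

/-- `p = (a, h, b)` is a Gaussian decomposition of `x`: `x = a h b` with `a ∈ N₋`, `h ∈ H`,
`b ∈ N`. It is unique when it exists. -/
def IsGauss {n : ℕ} (x : Mat n) (p : Mat n × Mat n × Mat n) : Prop :=
  p.1 ∈ Nminus n ∧ p.2.1 ∈ H n ∧ p.2.2 ∈ N n ∧ x = p.1 * p.2.1 * p.2.2

/-- `G₀ = N₋ H N`. -/
def G0 (n : ℕ) : Set (Mat n) :=
  {x | ∃ p, IsGauss x p}

open Classical in
/-- `[x]₋`, for `x ∈ G₀` (and `0` otherwise). -/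
def gaussMinus {n : ℕ} (x : Mat n) : Mat n :=
  if h : ∃ p, IsGauss x p then h.choose.1 else 0

open Classical in
/-- `[x]₊`, for `x ∈ G₀` (and `0` otherwise). -/
def gaussPlus {n : ℕ} (x : Mat n) : Mat n :=
  if h : ∃ p, IsGauss x p then h.choose.2.2 else 0

/-! ### Totally nonnegative unipotent matrices and their cells -/

/-- `Y`: the monoid generated by the matrices `x_i(t)` with `t ≥ 0`, where `x_i(t)` differs from
the identity only by the entry `t` in row `i` and column `i + 1`. -/
def Y (n : ℕ) : Submonoid (Mat n) :=
  Submonoid.closure {x | ∃ (i : Fin n) (h : i.val + 1 < n) (t : ℝ), 0 ≤ t ∧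
    x = Matrix.transvection i ⟨i.val + 1, h⟩ t}

/-- The cell `Y°_w = Y ∩ B₋ w B₋`. -/
def Ycell {n : ℕ} (w : Equiv.Perm (Fin n)) : Set (Mat n) :=
  (Y n : Set (Mat n)) ∩ bruhatCell w

/-- `Y_{≥ u}`, the union of the cells `Y°_v` over `v ≥ u`. -/
def Ygeq {n : ℕ} (u : Equiv.Perm (Fin n)) : Set (Mat n) :=
  {x | ∃ v, bruhatLE u v ∧ x ∈ Ycell v}

/-! ### The two projections -/

/-- `π_u(x) = [u [u⁻¹ [x u⁻¹]₊ u]₋]₊`. -/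
def piProj {n : ℕ} (u : Equiv.Perm (Fin n)) (x : Mat n) : Mat n :=
  gaussPlus (perm u * gaussMinus (perm u⁻¹ * gaussPlus (x * perm u⁻¹) * perm u))

/-- The fiber `π_u⁻¹(x_u)` of `π_u : Y_{≥ u} → Y°_u`. -/
def fiber {n : ℕ} (u : Equiv.Perm (Fin n)) (xu : Mat n) : Set (Mat n) :=
  {x | x ∈ Ygeq u ∧ piProj u x = xu}

/-- `m` is the element of `N₋(u)` that moves `x` into `x_u N(u)`: the element `[x m]₊` is well
defined and belongs to `x_u N(u)`. -/
def IsShift {n : ℕ} (u : Equiv.Perm (Fin n)) (xu x m : Mat n) : Prop :=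
  m ∈ NminusOf u ∧ x * m ∈ G0 n ∧ ∃ z ∈ NOf u, gaussPlus (x * m) = xu * z

open Classical in
/-- `ρ_{x_u}(x) = [x m]₊`, where `m` is the element of `N₋(u)` such that `[x m]₊` is well defined
and belongs to `x_u N(u)` (and `0` if there is none). -/
def rho {n : ℕ} (u : Equiv.Perm (Fin n)) (xu x : Mat n) : Mat n :=
  if h : ∃ m, IsShift u xu x m then gaussPlus (x * h.choose) else 0

/-! ### The torus scaling, the vector field and the function `str` -/

/-- `d(τ) = τ^{-(n-1)/2} diag(τ^{n-1}, τ^{n-2}, …, 1)`, for `τ > 0`. -/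
def torus (n : ℕ) (τ : ℝ) : Mat n :=
  τ ^ (-((n : ℝ) - 1) / 2) • Matrix.diagonal (fun i : Fin n => τ ^ (n - 1 - i.val))

/-- `d(τ) x d(τ)⁻¹`. -/
def scale {n : ℕ} (τ : ℝ) (x : Mat n) : Mat n :=
  torus n τ * x * (torus n τ)⁻¹

/-- `ψ(x)`, the derivative of `ρ_{x_u}(d(τ) x d(τ)⁻¹)` with respect to `τ` at `τ = 1`. -/
def psi {n : ℕ} (u : Equiv.Perm (Fin n)) (xu x : Mat n) : Mat n :=
  deriv (fun τ : ℝ => rho u xu (scale τ x)) 1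

/-- `str(x)`, the sum of the entries immediately above the main diagonal. -/
def str {n : ℕ} (x : Mat n) : ℝ :=
  ∑ i : Fin n, if h : i.val + 1 < n then x i ⟨i.val + 1, h⟩ else 0

end TNNLink

end

/-
Write `x = c u g` with `c ∈ B₋` and `g ∈ u⁻¹ N u`, and `g = l z` with `l ∈ N₋` and `z ∈ N`. Then
`π_u(x) = c u l`, so `x = x_u z` on the fiber. Conjugation by `d(τ)` changes `c u` only by a factor
in `B₋` on the left, whence `ρ(d(τ) x d(τ)⁻¹) = x_u [(d(τ) g⁻¹ d(τ)⁻¹) l]₊⁻¹`. Differentiating the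
factorization `G₀ = B₋ N` gives `ψ(x) = x A`, where `A` is the strictly upper triangular part of
`g⁻¹ D g` and `D = diag(0, -1, …, -(n - 1))`. Hence the derivative of `str` along `ψ` is the sum of
the entries `(q, q + 1)` of `g⁻¹ D g`, which are the sums over `i` of
`g⁻¹_{q,i} g_{i,q+1} (q + 1/2 - i)`.

Since `x ∈ Y_{≥u}`, the minors of `x` on its first `p` rows and the columns `u⁻¹ 0, …, u⁻¹ (p - 1)`
do not vanish. The entries of `g` and `g⁻¹` are, up to sign, ratios of such minors with one column
exchanged, and total nonnegativity fixes the signs so that every summand is nonnegative. Moreover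
the column sets of the nonzero minors are closed downward in the Gale order, so if `g` has a nonzero
entry above the diagonal, then some summand is nonzero. Otherwise `z = 1` and `x = x_u`.
-/

noncomputable section

namespace TNNLink

open Matrix Finset

section Unitriangular

variable {m α R : Type*} [DecidableEq m] [LinearOrder α] [CommRing R]

section
variable [Fintype m]

/-- The matrices which agree with the identity matrix at all positions `(i, j)` with `b j ≤ b i`:
the unipotent block upper triangular matrices whose diagonal blocks, given by the fibers of `b`,
are identity matrices. For `b = id` they are the upper unitriangular matrices and for
`b = OrderDual.toDual` the lower unitriangular ones. -/
def unitriangular (R : Type*) [CommRing R] (b : m → α) : Submonoid (Matrix m m R) where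
  carrier := {A | ∀ i j, b j ≤ b i → A i j = (1 : Matrix m m R) i j}
  one_mem' := fun _ _ _ => rfl
  mul_mem' := by
    intro A C hA hC i j hij
    rw [← hC i j hij, ← one_mul C, ← mul_assoc, mul_one, mul_apply, mul_apply]
    refine sum_congr rfl fun k _ => ?_
    obtain hk | hk := le_or_gt (b k) (b i)
    · rw [hA i k hk]
    · rw [hC k j (hij.trans hk.le), one_apply_ne (show k ≠ j from ?_), mul_zero, mul_zero]
      rintro rfl
      exact hij.not_gt hk

variable {b : m → α} {A : Matrix m m R}

lemma unitriangular.blockTriangular (hA : A ∈ unitriangular R b) : A.BlockTriangular b :=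
  fun i j hij => by rw [hA i j hij.le, one_apply_ne (ne_of_apply_ne b hij.ne')]

lemma unitriangular.diag (hA : A ∈ unitriangular R b) (i : m) : A i i = 1 := by
  rw [hA i i le_rfl, one_apply_eq]

lemma mem_unitriangular_of_injective (hb : Function.Injective b) :
    A ∈ unitriangular R b ↔ A.BlockTriangular b ∧ ∀ i, A i i = 1 := by
  refine ⟨fun hA => ⟨unitriangular.blockTriangular hA, unitriangular.diag hA⟩, ?_⟩
  rintro ⟨hA, hd⟩ i j hij
  obtain hij | hij := hij.lt_or_eq
  · rw [hA hij, one_apply_ne (ne_of_apply_ne b hij.ne')]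
  · rw [hb hij, hd, one_apply_eq]

lemma unitriangular.det_eq_one (hA : A ∈ unitriangular R b) : A.det = 1 := by
  rw [(unitriangular.blockTriangular hA).det]
  refine prod_eq_one fun a _ => ?_
  have : A.toSquareBlock b a = 1 := by
    ext i j
    rw [toSquareBlock_def, of_apply, hA i j (by rw [i.2, j.2]), one_apply, one_apply]
    simp only [Subtype.ext_iff]
  rw [this, det_one]

lemma unitriangular.isUnit_det (hA : A ∈ unitriangular R b) : IsUnit A.det :=
  unitriangular.det_eq_one hA ▸ isUnit_one

lemma unitriangular.inv_mem (hA : A ∈ unitriangular R b) : A⁻¹ ∈ unitriangular R b := by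
  have := A.invertibleOfIsUnitDet (unitriangular.isUnit_det hA)
  have hinv : A⁻¹.BlockTriangular b :=
    blockTriangular_inv_of_blockTriangular (unitriangular.blockTriangular hA)
  intro i j hij
  rw [← nonsing_inv_mul A (unitriangular.isUnit_det hA), ← mul_one A⁻¹, mul_assoc, one_mul,
    mul_apply, mul_apply]
  refine sum_congr rfl fun k _ => ?_
  obtain hk | hk := le_or_gt (b j) (b k)
  · rw [hA k j hk]
  · rw [hinv (hk.trans_le hij), zero_mul, zero_mul]

lemma unitriangular.submatrix {m' : Type*} [Fintype m'] [DecidableEq m'] {e : m' → m}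
    (he : Function.Injective e) (hA : A ∈ unitriangular R b) :
    A.submatrix e e ∈ unitriangular R (b ∘ e) := fun i j hij => by
  rw [submatrix_apply, hA _ _ hij, one_apply, one_apply]
  simp only [he.eq_iff]

lemma eq_one_of_mem_unitriangular_toDual (hA : A ∈ unitriangular R b)
    (hA' : A ∈ unitriangular R (OrderDual.toDual ∘ b)) : A = 1 := by
  ext i j
  exact (le_total (b j) (b i)).elim (hA i j) (hA' i j)

end

end Unitriangular

lemma det_of_blockTriangular_injective {m α R : Type*} [Fintype m] [DecidableEq m]
    [LinearOrder α] [CommRing R] {A : Matrix m m R} {b : m → α} (hb : Function.Injective b)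
    (hA : A.BlockTriangular b) : A.det = ∏ i, A i i := by
  let : LinearOrder m := LinearOrder.lift' b hb
  rw [← det_of_isUpperTriangular (M := A) fun i j hij => hA hij]

section ColumnElimination

variable {m R : Type*} [Fintype m] [DecidableEq m] [CommRing R]

lemma exists_column_elimination (y : Matrix m m R) (S : m → Finset m) (hS : ∀ j, j ∉ S j)
    (hy : ∀ j, IsUnit (y.submatrix (Subtype.val : S j → m) Subtype.val).det) :
    ∃ a : Matrix m m R, (∀ i j, i ∉ S j → a i j = (1 : Matrix m m R) i j) ∧
      ∀ j, ∀ i ∈ S j, (y * a) i j = 0 := by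
  let w (j : m) : S j → R :=
    (y.submatrix (Subtype.val : S j → m) (Subtype.val : S j → m))⁻¹ *ᵥ fun i => -y i.1 j
  have hw (j) (i : S j) : ∑ k : S j, y i.1 k.1 * w j k = -y i.1 j := by
    have : y.submatrix (Subtype.val : S j → m) Subtype.val *ᵥ w j =
        fun i : S j => -y i.1 j := by
      rw [mulVec_mulVec, mul_nonsing_inv _ (hy j), one_mulVec]
    exact congrFun this i
  let a : Matrix m m R := of fun i j =>
    if h : i ∈ S j then w j ⟨i, h⟩ else (1 : Matrix m m R) i j
  have ha_mem (j) (i : S j) : a i.1 j = w j i := dif_pos i.2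
  have ha_notMem (i j) (h : i ∉ S j) : a i j = (1 : Matrix m m R) i j := dif_neg h
  refine ⟨a, ha_notMem, fun j i hi => ?_⟩
  have hcompl : ∑ k ∈ (S j)ᶜ, y i k * a k j = y i j := by
    rw [sum_eq_single_of_mem j (mem_compl.2 (hS j)), ha_notMem j j (hS j), one_apply_eq, mul_one]
    intro k hk hkj
    rw [ha_notMem k j (mem_compl.1 hk), one_apply_ne hkj, mul_zero]
  rw [mul_apply, ← sum_add_sum_compl (S j), hcompl, ← sum_coe_sort (S j)]
  simp only [ha_mem]
  rw [hw j ⟨i, hi⟩, neg_add_cancel]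

variable [LinearOrder m]

lemma unitriangular.exists_lower_mul_upper {α : Type*} [LinearOrder α] {b : m → α}
    {g : Matrix m m R} (hg : g ∈ unitriangular R b) :
    ∃ l ∈ unitriangular R b ⊓ unitriangular R OrderDual.toDual,
      ∃ z ∈ unitriangular R b ⊓ unitriangular R id, g = l * z := by
  obtain ⟨a, ha, hga⟩ := exists_column_elimination g
    (fun j => univ.filter fun i => i < j ∧ b i < b j) (by simp)
    (fun j => unitriangular.isUnit_det (unitriangular.submatrix Subtype.val_injective hg))
  simp only [mem_filter, mem_univ, true_and, not_and_or, not_lt] at ha hga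
  have hab : a ∈ unitriangular R b := fun i j hij => ha i j (.inr hij)
  have haN : a ∈ unitriangular R id := fun i j hij => ha i j (.inl hij)
  have hgab := mul_mem hg hab
  refine ⟨g * a, ⟨hgab, fun i j hij => ?_⟩, a⁻¹,
    ⟨unitriangular.inv_mem hab, unitriangular.inv_mem haN⟩,
    (mul_nonsing_inv_cancel_right _ _ (unitriangular.isUnit_det hab)).symm⟩
  obtain hb | hb := le_or_gt (b j) (b i)
  · exact hgab i j hb
  · have hne : i ≠ j := ne_of_apply_ne b hb.ne
    rw [hga j i ⟨lt_of_le_of_ne hij hne, hb⟩, one_apply_ne hne]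

lemma exists_lowerTriangular_mul_unitriangular {y : Matrix m m R} (hdet : IsUnit y.det)
    (hy : ∀ j, IsUnit (y.submatrix (Subtype.val : {i // i < j} → m) Subtype.val).det) :
    ∃ c : Matrix m m R, c.IsLowerTriangular ∧ IsUnit c.det ∧
      ∃ a ∈ unitriangular R (id : m → m), y = c * a := by
  obtain ⟨a, ha, hya⟩ := exists_column_elimination y (fun j => univ.filter fun i => i < j)
    (by simp) (fun j => by
      rw [← det_submatrix_equiv_self (Equiv.subtypeEquivRight (p := (· < j)) (by simp))]
      exact hy j)
  simp only [mem_filter, mem_univ, true_and, not_lt] at ha hya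
  have haN : a ∈ unitriangular R id := ha
  refine ⟨y * a, fun i j hij => hya j i hij, ?_, a⁻¹, unitriangular.inv_mem haN,
    (mul_nonsing_inv_cancel_right _ _ (unitriangular.isUnit_det haN)).symm⟩
  rw [det_mul]
  exact hdet.mul (unitriangular.isUnit_det haN)

end ColumnElimination

section Gauss

variable {n : ℕ} {c c' a a' l x : Mat n}

lemma mem_N_iff : a ∈ N n ↔ a ∈ unitriangular ℝ (id : Fin n → Fin n) :=
  (mem_unitriangular_of_injective Function.injective_id).symm

lemma mem_Nminus_iff : l ∈ Nminus n ↔ l ∈ unitriangular ℝ (OrderDual.toDual : Fin n → _) :=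
  (mem_unitriangular_of_injective OrderDual.toDual.injective).symm

lemma mem_Bminus_iff : c ∈ Bminus n ↔ c.IsLowerTriangular ∧ IsUnit c.det := by
  refine and_congr_right fun hc => ?_
  rw [det_of_isLowerTriangular (M := c) hc, isUnit_iff_ne_zero, prod_ne_zero_iff]
  simp

lemma mul_mem_Bminus (hc : c ∈ Bminus n) (hc' : c' ∈ Bminus n) : c * c' ∈ Bminus n := by
  rw [mem_Bminus_iff] at *
  exact ⟨hc.1.mul hc'.1, by rw [det_mul]; exact hc.2.mul hc'.2⟩

lemma inv_mem_Bminus (hc : c ∈ Bminus n) : c⁻¹ ∈ Bminus n := by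
  rw [mem_Bminus_iff] at *
  have := c.invertibleOfIsUnitDet hc.2
  exact ⟨blockTriangular_inv_of_blockTriangular hc.1, isUnit_nonsing_inv_det c hc.2⟩

lemma Nminus_subset_Bminus : Nminus n ⊆ Bminus n :=
  fun _ hl => ⟨hl.1, fun i => by rw [hl.2]; exact one_ne_zero⟩

lemma one_mem_Bminus : (1 : Mat n) ∈ Bminus n :=
  Nminus_subset_Bminus (mem_Nminus_iff.2 (one_mem _))

lemma H_subset_Bminus : H n ⊆ Bminus n :=
  fun _ hh => ⟨fun i j hij => hh.1 i j hij.ne, hh.2⟩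

lemma eq_one_of_mem_Bminus_of_mem_N (hc : c ∈ Bminus n) (hc' : c ∈ N n) : c = 1 :=
  eq_one_of_mem_unitriangular_toDual (mem_N_iff.1 hc') (mem_Nminus_iff.1 ⟨hc.1, hc'.2⟩)

lemma right_eq_of_Bminus_mul_N_eq (hc : c ∈ Bminus n) (hc' : c' ∈ Bminus n) (ha : a ∈ N n)
    (ha' : a' ∈ N n) (h : c * a = c' * a') : a = a' := by
  rw [mem_N_iff] at ha ha'
  have hu := unitriangular.isUnit_det ha'
  have hquot : c⁻¹ * c' = a * a'⁻¹ := by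
    rw [← mul_nonsing_inv_cancel_right a' (c⁻¹ * c') hu, mul_assoc c⁻¹, ← h,
      nonsing_inv_mul_cancel_left _ _ (mem_Bminus_iff.1 hc).2]
  have hone : a * a'⁻¹ = 1 := eq_one_of_mem_Bminus_of_mem_N
    (hquot ▸ mul_mem_Bminus (inv_mem_Bminus hc) hc')
    (mem_N_iff.2 (mul_mem ha (unitriangular.inv_mem ha')))
  rw [← nonsing_inv_mul_cancel_right a' a hu, hone, one_mul]

lemma exists_isGauss (hc : c ∈ Bminus n) (ha : a ∈ N n) : ∃ p, IsGauss (c * a) p := by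
  refine ⟨(c * diagonal fun i => (c i i)⁻¹, diagonal fun i => c i i, a),
    ⟨?_, ?_⟩, ⟨?_, ?_⟩, ha, ?_⟩
  · intro i j hij
    change (c * diagonal fun i => (c i i)⁻¹) i j = 0
    rw [mul_diagonal, hc.1 i j hij, zero_mul]
  · intro i
    change (c * diagonal fun i => (c i i)⁻¹) i i = 1
    rw [mul_diagonal, mul_inv_cancel₀ (hc.2 i)]
  · intro i j hij
    exact diagonal_apply_ne _ hij
  · intro i
    exact (diagonal_apply_eq _ i).trans_ne (hc.2 i)
  · rw [mul_assoc c, diagonal_mul_diagonal]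
    simp only [inv_mul_cancel₀ (hc.2 _), diagonal_one, mul_one]

lemma mul_mem_G0 (hc : c ∈ Bminus n) (ha : a ∈ N n) : c * a ∈ G0 n :=
  exists_isGauss hc ha

lemma gaussPlus_mul (hc : c ∈ Bminus n) (ha : a ∈ N n) : gaussPlus (c * a) = a := by
  have h := exists_isGauss hc ha
  rw [gaussPlus, dif_pos h]
  obtain ⟨hl, hh, hp, heq⟩ := h.choose_spec
  exact right_eq_of_Bminus_mul_N_eq
    (mul_mem_Bminus (Nminus_subset_Bminus hl) (H_subset_Bminus hh)) hc hp ha heq.symm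

lemma gaussMinus_mul (hl : l ∈ Nminus n) (ha : a ∈ N n) : gaussMinus (l * a) = l := by
  have h := exists_isGauss (Nminus_subset_Bminus hl) ha
  rw [gaussMinus, dif_pos h]
  obtain ⟨hl', hh, hp, heq⟩ := h.choose_spec
  generalize h.choose = p at *
  have hB := mul_mem_Bminus (Nminus_subset_Bminus hl') (H_subset_Bminus hh)
  have hpa : a = p.2.2 :=
    right_eq_of_Bminus_mul_N_eq (Nminus_subset_Bminus hl) hB ha hp heq
  have hll : p.1⁻¹ * l = p.2.1 := by
    have hu := unitriangular.isUnit_det (mem_N_iff.1 ha)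
    rw [← hpa] at heq
    rw [← mul_nonsing_inv_cancel_right a l hu, heq, mul_nonsing_inv_cancel_right _ _ hu,
      nonsing_inv_mul_cancel_left _ _ (mem_Bminus_iff.1 (Nminus_subset_Bminus hl')).2]
  have hone : p.1⁻¹ * l = 1 := by
    have hmem : p.1⁻¹ * l ∈ Nminus n := mem_Nminus_iff.2
      (mul_mem (unitriangular.inv_mem (mem_Nminus_iff.1 hl')) (mem_Nminus_iff.1 hl))
    refine eq_one_of_mem_Bminus_of_mem_N (Nminus_subset_Bminus hmem) ⟨fun i j hij => ?_, hmem.2⟩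
    rw [hll, hh.1 i j hij.ne']
  rw [← mul_one p.1, ← hone,
    mul_nonsing_inv_cancel_left _ _ (mem_Bminus_iff.1 (Nminus_subset_Bminus hl')).2]

lemma exists_eq_mul_gaussPlus (hx : x ∈ G0 n) :
    ∃ c ∈ Bminus n, gaussPlus x ∈ N n ∧ x = c * gaussPlus x := by
  obtain ⟨⟨l, h, a⟩, hl, hh, ha, rfl⟩ := hx
  have hc := mul_mem_Bminus (Nminus_subset_Bminus hl) (H_subset_Bminus hh)
  rw [gaussPlus_mul hc ha]
  exact ⟨_, hc, ha, rfl⟩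

end Gauss

section Permutation

variable {n : ℕ} (x : Mat n) (u w : Equiv.Perm (Fin n)) (i j : Fin n)

lemma mul_perm_apply : (x * perm w) i j = x i (w j) := by
  rw [perm, Equiv.Perm.permMatrix, PEquiv.mul_toMatrix_toPEquiv]
  rfl

lemma perm_mul_apply : (perm w * x) i j = x (w⁻¹ i) j := by
  simp [perm, Equiv.Perm.permMatrix, PEquiv.toMatrix_toPEquiv_mul]

lemma perm_mul_perm_inv : perm w * perm w⁻¹ = 1 := by
  ext i j
  rw [mul_perm_apply, perm, one_apply]
  simp [Equiv.Perm.permMatrix, PEquiv.toMatrix_apply]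

lemma perm_inv_mul_perm : perm w⁻¹ * perm w = 1 := by
  simpa using perm_mul_perm_inv w⁻¹

lemma perm_mul_mul_perm_inv : perm u * x * perm u⁻¹ = x.submatrix ⇑u⁻¹ ⇑u⁻¹ := by
  ext i j
  rw [mul_perm_apply, perm_mul_apply, submatrix_apply]

variable {x u}

lemma perm_conj_mem_B_iff (hx : ∀ i, x i i = 1) :
    perm u * x * perm u⁻¹ ∈ B n ↔ x ∈ unitriangular ℝ u := by
  rw [perm_mul_mul_perm_inv, mem_unitriangular_of_injective u.injective]
  refine ⟨fun h => ⟨fun i j hij => ?_, hx⟩, fun h => ⟨fun i j hij => ?_, fun i => ?_⟩⟩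
  · simpa using h.1 _ _ hij
  · exact h.1 (by simpa using hij)
  · rw [submatrix_apply, hx]
    exact one_ne_zero

lemma mem_NminusOf_iff :
    x ∈ NminusOf u ↔ x ∈ unitriangular ℝ u ⊓ unitriangular ℝ OrderDual.toDual := by
  refine (and_congr_left fun h => perm_conj_mem_B_iff h.2).trans (and_congr_right fun _ => ?_)
  exact mem_Nminus_iff

lemma mem_NOf_iff : x ∈ NOf u ↔ x ∈ unitriangular ℝ u ⊓ unitriangular ℝ id := by
  refine (and_congr_left fun h => perm_conj_mem_B_iff h.2).trans (and_congr_right fun _ => ?_)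
  exact mem_N_iff

lemma perm_conj_mem_N (hx : x ∈ unitriangular ℝ u) : perm u * x * perm u⁻¹ ∈ N n := by
  rw [perm_mul_mul_perm_inv, mem_N_iff]
  convert unitriangular.submatrix u⁻¹.injective hx
  ext i
  simp

lemma perm_inv_conj_mem_unitriangular (hx : x ∈ N n) :
    perm u⁻¹ * x * perm u ∈ unitriangular ℝ u := by
  have h := perm_mul_mul_perm_inv x u⁻¹
  rw [inv_inv] at h
  rw [h]
  exact unitriangular.submatrix u.injective (mem_N_iff.1 hx)

end Permutation

section FlagMinor

variable {n p : ℕ} (hp : p ≤ n) (s : Fin p → Fin n) {c x : Mat n}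

/-- The flag minor of `x` on the rows `0, …, p - 1` and the columns `s 0, …, s (p - 1)`, listed in
this order. Sequences of columns are used instead of sets, so that exchanging a single column is
`Function.update`; the resulting signs are compensated by `vdm`. -/
def flagMinor (hp : p ≤ n) (s : Fin p → Fin n) (x : Mat n) : ℝ :=
  (x.submatrix (Fin.castLE hp) s).det

variable {s} in
lemma injective_of_flagMinor_ne_zero (h : flagMinor hp s x ≠ 0) : Function.Injective s := by
  intro a b hab
  by_contra hne
  exact h (det_zero_of_column_eq hne fun i => by rw [submatrix_apply, submatrix_apply, hab])

lemma flagMinor_comp_perm (σ : Equiv.Perm (Fin p)) (x : Mat n) :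
    flagMinor hp (s ∘ σ) x = (Equiv.Perm.sign σ : ℤ) * flagMinor hp s x := by
  rw [flagMinor, flagMinor, ← det_permute']
  rfl

lemma flagMinor_mul_perm (x : Mat n) (w : Equiv.Perm (Fin n)) :
    flagMinor hp s (x * perm w) = flagMinor hp (w ∘ s) x := by
  rw [flagMinor, flagMinor]
  congr 1
  ext i j
  rw [submatrix_apply, mul_perm_apply, submatrix_apply, Function.comp_apply]

lemma flagMinor_lower_mul (hc : c.IsLowerTriangular) (x : Mat n) :
    flagMinor hp s (c * x) = flagMinor hp (Fin.castLE hp) c * flagMinor hp s x := by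
  rw [flagMinor, flagMinor, flagMinor, ← det_mul]
  congr 1
  ext i j
  rw [submatrix_apply, mul_apply, mul_apply]
  refine (Fintype.sum_of_injective (Fin.castLE hp) (Fin.castLE_injective hp) _ _
    (fun k hk => ?_) fun k => rfl).symm
  have hik : Fin.castLE hp i < k := by
    by_contra! hki
    exact hk ⟨⟨k, lt_of_le_of_lt hki i.2⟩, rfl⟩
  rw [hc (i := Fin.castLE hp i) hik, zero_mul]

lemma flagMinor_castLE_ne_zero_of_mem_Bminus (hc : c ∈ Bminus n) :
    flagMinor hp (Fin.castLE hp) c ≠ 0 := by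
  rw [flagMinor, det_of_isLowerTriangular (M := c.submatrix _ _) fun i j hij => hc.1 _ _ hij]
  exact prod_ne_zero_iff.2 fun i _ => hc.2 _

lemma continuous_flagMinor : Continuous (flagMinor hp s) :=
  (continuous_id.matrix_submatrix _ _).matrix_det

lemma exists_Bminus_mul_N (h : ∀ p (hp : p ≤ n), flagMinor hp (Fin.castLE hp) x ≠ 0) :
    ∃ c ∈ Bminus n, ∃ a ∈ N n, x = c * a := by
  obtain ⟨c, hc, hcdet, a, ha, hx⟩ := exists_lowerTriangular_mul_unitriangular (y := x)
    (h n le_rfl).isUnit (fun j => by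
      rw [← det_submatrix_equiv_self (Fin.castLEquiv j.2.le)]
      exact (h j j.2.le).isUnit)
  exact ⟨c, mem_Bminus_iff.2 ⟨hc, hcdet⟩, a, mem_N_iff.2 ha, hx⟩

variable {s}

lemma flagMinor_mul_transvection_of_notMem {i j : Fin n} (hj : ∀ a, s a ≠ j) (t : ℝ) (x : Mat n) :
    flagMinor hp s (x * transvection i j t) = flagMinor hp s x := by
  rw [flagMinor, flagMinor]
  congr 1
  ext k a
  rw [submatrix_apply, submatrix_apply, mul_transvection_apply_of_ne _ _ _ _ (hj a)]

lemma flagMinor_mul_transvection (hs : Function.Injective s) {i j : Fin n} {a : Fin p}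
    (ha : s a = j) (t : ℝ) (x : Mat n) :
    flagMinor hp s (x * transvection i j t)
      = flagMinor hp s x + t * flagMinor hp (Function.update s a i) x := by
  have hcol : (x * transvection i j t).submatrix (Fin.castLE hp) s
      = (x.submatrix (Fin.castLE hp) s).updateCol a
        ((fun k => x (Fin.castLE hp k) j) + t • fun k => x (Fin.castLE hp k) i) := by
    ext k b
    rw [submatrix_apply, updateCol_apply]
    split_ifs with hb
    · rw [hb, ha, mul_transvection_apply_same]
      rfl
    · rw [mul_transvection_apply_of_ne _ _ _ _ (ha ▸ hs.ne hb), submatrix_apply]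
  have hupd (m : Fin n) : (x.submatrix (Fin.castLE hp) s).updateCol a
      (fun k => x (Fin.castLE hp k) m) = x.submatrix (Fin.castLE hp) (Function.update s a m) := by
    ext k b
    rw [updateCol_apply, submatrix_apply, submatrix_apply, Function.update_apply,
      apply_ite (x (Fin.castLE hp k))]
  rw [flagMinor, hcol, det_updateCol_add, det_updateCol_smul, hupd, hupd, ← ha,
    Function.update_eq_self]
  rfl

end FlagMinor

section Vandermonde

lemma exists_det_vandermonde_update {R : Type*} [CommRing R] {p : ℕ} (v : Fin p → R)
    (a : Fin p) : ∃ w, ∀ y,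
      (vandermonde (Function.update v a y)).det = w * ∏ b ∈ univ.erase a, (y - v b) := by
  let F (v : Fin p → R) (i j : Fin p) : R := if i < j then v j - v i else 1
  have hdet (v : Fin p → R) : (vandermonde v).det =
      (∏ b ∈ univ.erase a, F v a b * F v b a) *
        ∏ i ∈ univ.erase a, ∏ j ∈ univ.erase a, F v i j := by
    have hprod (i : Fin p) :
        ∏ j ∈ Ioi i, (v j - v i) = F v i a * ∏ j ∈ univ.erase a, F v i j := by
      rw [mul_prod_erase univ (F v i) (mem_univ a), prod_ite, prod_const_one, mul_one,
        filter_lt_eq_Ioi]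
    simp only [det_vandermonde, hprod]
    rw [prod_mul_distrib, ← mul_prod_erase _ _ (mem_univ a),
      ← mul_prod_erase univ (fun i => ∏ j ∈ univ.erase a, F v i j) (mem_univ a),
      prod_mul_distrib]
    simp only [F, lt_self_iff_false, if_false]
    ring
  refine ⟨(∏ b ∈ univ.erase a, if a < b then -1 else 1) *
    ∏ i ∈ univ.erase a, ∏ j ∈ univ.erase a, F v i j, fun y => ?_⟩
  rw [hdet, mul_right_comm]
  congr 1
  · rw [← prod_mul_distrib]
    refine prod_congr rfl fun b hb => ?_
    have hba := ne_of_mem_erase hb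
    simp only [F, Function.update_self, Function.update_of_ne hba]
    obtain h | h := hba.lt_or_gt
    · rw [if_neg h.not_gt, if_pos h, if_neg h.not_gt]
    · rw [if_pos h, if_neg h.not_gt, if_pos h]
      ring
  · refine prod_congr rfl fun i hi => prod_congr rfl fun j hj => ?_
    simp only [F, Function.update_of_ne (ne_of_mem_erase hi),
      Function.update_of_ne (ne_of_mem_erase hj)]

variable {n p : ℕ} {s : Fin p → Fin n}

/-- The Vandermonde determinant of `s`. Its sign is that of the permutation sorting `s`, so that
`vdm s * flagMinor hp s x` has the sign of the flag minor on the sorted columns. -/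
def vdm (s : Fin p → Fin n) : ℝ :=
  (vandermonde fun a => (s a : ℝ)).det

lemma vdm_ne_zero_iff : vdm s ≠ 0 ↔ Function.Injective s :=
  det_vandermonde_ne_zero_iff.trans
    ((Nat.cast_injective.comp Fin.val_injective).of_comp_iff s)

lemma vdm_comp_perm (s : Fin p → Fin n) (σ : Equiv.Perm (Fin p)) :
    vdm (s ∘ σ) = (Equiv.Perm.sign σ : ℤ) * vdm s := by
  rw [vdm, vdm, ← det_permute]
  rfl

lemma vdm_pos_of_strictMono (hs : StrictMono s) : 0 < vdm s := by
  rw [vdm, det_vandermonde]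
  refine prod_pos fun i _ => prod_pos fun j hj => sub_pos.2 ?_
  exact_mod_cast hs (mem_Ioi.1 hj)

lemma vdm_update_mul_vdm_nonneg (s : Fin p → Fin n) (a : Fin p) (k : Fin n) :
    0 ≤ vdm (Function.update s a k) * vdm s *
      ∏ b ∈ univ.erase a, ((s a : ℝ) - s b) * ((k : ℝ) - s b) := by
  obtain ⟨w, hw⟩ := exists_det_vandermonde_update (fun b => (s b : ℝ)) a
  have hvdm (k : Fin n) : vdm (Function.update s a k) =
      w * ∏ b ∈ univ.erase a, ((k : ℝ) - s b) := by
    rw [← hw, vdm]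
    congr 2
    ext b
    rw [Function.update_apply, Function.update_apply, apply_ite Fin.val, Nat.cast_ite]
  rw [prod_mul_distrib]
  nth_rw 2 [← Function.update_eq_self a s]
  rw [hvdm, hvdm]
  linarith [sq_nonneg (w * (∏ b ∈ univ.erase a, ((s a : ℝ) - s b)) *
    ∏ b ∈ univ.erase a, ((k : ℝ) - s b))]

end Vandermonde

section GaleOrder

variable {n p : ℕ} {s t : Fin p → Fin n} {a : Fin p} {i j : Fin n}

/-- The number of terms of `s` that are at least `j`. -/
def countGE (s : Fin p → Fin n) (j : ℕ) : ℕ :=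
  #{a | j ≤ (s a : ℕ)}

/-- The Gale order on the underlying sets of two injective sequences of the same length: the
`k`-th smallest term of `t` is at most the `k`-th smallest term of `s`, for all `k`. It is expressed
through the counting functions, which do not require sorting. -/
def GaleLE (t s : Fin p → Fin n) : Prop :=
  ∀ j, countGE t j ≤ countGE s j

lemma galeLE_of_le (h : ∀ a, t a ≤ s a) : GaleLE t s := fun j =>
  card_le_card fun a ha => by
    rw [mem_filter_univ] at ha ⊢
    exact ha.trans (h a)

lemma countGE_eq_zero_iff {j : ℕ} : countGE s j = 0 ↔ ∀ a, (s a : ℕ) < j := by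
  simp [countGE, filter_eq_empty_iff]

lemma countGE_eq_succ_add (s : Fin p → Fin n) (j : ℕ) :
    countGE s j = countGE s (j + 1) + #{a | (s a : ℕ) = j} := by
  rw [countGE, countGE, ← card_union_of_disjoint, ← filter_or]
  · congr 1
    exact filter_congr fun a _ => by omega
  · exact disjoint_filter.2 fun a _ => by omega

lemma countGE_update_add (s : Fin p → Fin n) (a : Fin p) (k : Fin n) (j : ℕ) :
    countGE (Function.update s a k) j + (if j ≤ (s a : ℕ) then 1 else 0)
      = countGE s j + (if j ≤ (k : ℕ) then 1 else 0) := by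
  simp only [countGE, card_filter]
  rw [← add_sum_erase _ _ (mem_univ a),
    ← add_sum_erase univ (fun b => if j ≤ (s b : ℕ) then 1 else 0) (mem_univ a),
    Function.update_self, sum_congr rfl fun b hb => by
      rw [Function.update_of_ne (ne_of_mem_erase hb)]]
  omega

lemma countGE_update_pred (s : Fin p → Fin n) {a : Fin p} (hij : (j : ℕ) = i + 1) (ha : s a = j)
    (k : ℕ) : countGE (Function.update s a i) k + (if k = j then 1 else 0) = countGE s k := by
  have hadd := countGE_update_add s a i k
  rw [ha] at hadd
  split_ifs at hadd ⊢ <;> omega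

lemma injective_update (hs : Function.Injective s) (hi : ∀ b, s b ≠ i) (a : Fin p) :
    Function.Injective (Function.update s a i) := by
  intro b c hbc
  rw [Function.update_apply, Function.update_apply] at hbc
  split_ifs at hbc with hb hc hc
  · rw [hb, hc]
  · exact absurd hbc.symm (hi c)
  · exact absurd hbc (hi b)
  · exact hs hbc

lemma ne_of_injective_update (h : Function.Injective (Function.update s a i)) (ha : s a ≠ i)
    (b : Fin p) : s b ≠ i := by
  rintro rfl
  have hba : b ≠ a := by
    rintro rfl
    exact ha rfl
  exact hba (h (by rw [Function.update_of_ne hba, Function.update_self]))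

lemma GaleLE.exchange (hts : GaleLE t s) (hij : (j : ℕ) = i + 1) (ha : s a = j)
    (hi : ∀ b, s b ≠ i) :
    GaleLE t (Function.update s a i) ∨ ∃ b, t b = j ∧ (∀ c, t c ≠ i) ∧
      GaleLE (Function.update t b i) (Function.update s a i) := by
  have hcard (r : Fin p → Fin n) (k : Fin n) :
      #{b | (r b : ℕ) = k} = 0 ↔ ∀ b, r b ≠ k := by
    simp [filter_eq_empty_iff, Fin.ext_iff]
  have hsi : #{b | (s b : ℕ) = i} = 0 := (hcard s i).2 hi
  have hsj : #{b | (s b : ℕ) = j} ≠ 0 := fun h => (hcard s j).1 h a ha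
  have hsi' := countGE_eq_succ_add s i
  have hsj' := countGE_eq_succ_add s j
  have hti' := countGE_eq_succ_add t i
  have htj' := countGE_eq_succ_add t j
  rw [← hij] at hsi' hti'
  have hi_le := hts i
  have hj_le := hts j
  have hj_succ_le := hts (j + 1)
  obtain hlt | heq := hj_le.lt_or_eq
  · refine .inl fun k => ?_
    have := countGE_update_pred s hij ha k
    have := hts k
    split_ifs at * with hk
    · subst hk
      omega
    · omega
  · obtain ⟨b, hb⟩ : ∃ b, t b = j := by
      by_contra! h
      have := (hcard t j).2 h
      omega
    refine .inr ⟨b, hb, (hcard t i).1 (by omega), fun k => ?_⟩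
    have := countGE_update_pred s hij ha k
    have := countGE_update_pred t hij hb k
    have := hts k
    omega

end GaleOrder

section FlagNonneg

variable {n p : ℕ} {x y : Mat n} {i j : Fin n}

/-- The two properties of totally nonnegative unitriangular matrices on which the proof rests: the
flag minors on increasing sequences of columns are nonnegative, and the sets of columns with
nonzero flag minor are closed downward in the Gale order. -/
structure FlagNonneg (x : Mat n) : Prop where
  nonneg (p : ℕ) (hp : p ≤ n) (s : Fin p → Fin n) : 0 ≤ vdm s * flagMinor hp s x
  down (p : ℕ) (hp : p ≤ n) (s t : Fin p → Fin n) : Function.Injective t → GaleLE t s →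
    flagMinor hp s x ≠ 0 → flagMinor hp t x ≠ 0

lemma exists_perm_of_forall_lt (hp : p ≤ n) {s : Fin p → Fin n} (hs : Function.Injective s)
    (h : ∀ a, (s a : ℕ) < p) : ∃ σ : Equiv.Perm (Fin p), s = Fin.castLE hp ∘ σ := by
  have hinj : Function.Injective fun a : Fin p => (⟨s a, h a⟩ : Fin p) := fun a b hab =>
    hs (Fin.ext (Fin.mk.inj hab))
  exact ⟨Equiv.ofBijective _ (Finite.injective_iff_bijective.1 hinj), rfl⟩

lemma flagMinor_castLE_one (hp : p ≤ n) : flagMinor hp (Fin.castLE hp) 1 = 1 := by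
  rw [flagMinor, submatrix_one _ (Fin.castLE_injective hp), det_one]

lemma flagMinor_one_eq_zero (hp : p ≤ n) {s : Fin p → Fin n} {a : Fin p} (ha : p ≤ (s a : ℕ)) :
    flagMinor hp s 1 = 0 := by
  refine det_eq_zero_of_column_eq_zero a fun k => ?_
  exact one_apply_ne (Fin.ne_of_lt (k.2.trans_le ha))

lemma flagNonneg_one : FlagNonneg (1 : Mat n) where
  nonneg p hp s := by
    by_cases hs : flagMinor hp s 1 = 0
    · rw [hs, mul_zero]
    obtain ⟨σ, rfl⟩ := exists_perm_of_forall_lt hp (injective_of_flagMinor_ne_zero hp hs)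
      fun a => not_le.1 fun ha => hs (flagMinor_one_eq_zero hp ha)
    rw [flagMinor_comp_perm, vdm_comp_perm, mul_mul_mul_comm, flagMinor_castLE_one, mul_one]
    exact mul_nonneg (mul_self_nonneg _) (vdm_pos_of_strictMono (Fin.strictMono_castLE hp)).le
  down p hp s t ht hts hs := by
    have hsp : countGE s p = 0 := countGE_eq_zero_iff.2 fun a =>
      not_le.1 fun ha => hs (flagMinor_one_eq_zero hp ha)
    obtain ⟨σ, rfl⟩ := exists_perm_of_forall_lt hp ht
      (countGE_eq_zero_iff.1 (Nat.le_zero.1 (hsp ▸ hts p)))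
    rw [flagMinor_comp_perm, flagMinor_castLE_one, mul_one]
    exact_mod_cast (Equiv.Perm.sign σ).ne_zero

lemma sub_mul_sub_pos_of_adjacent {k : Fin n} (hij : (j : ℕ) = i + 1) (hki : k ≠ i)
    (hkj : k ≠ j) : 0 < ((i : ℝ) - k) * ((j : ℝ) - k) := by
  rw [Fin.ne_iff_vne] at hki hkj
  obtain h | h := hki.lt_or_gt
  · exact mul_pos (sub_pos.2 (mod_cast h)) (sub_pos.2 (mod_cast (by omega : (k : ℕ) < j)))
  · exact mul_pos_of_neg_of_neg (sub_neg.2 (mod_cast h))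
      (sub_neg.2 (mod_cast (by omega : (j : ℕ) < k)))

lemma vdm_update_mul_vdm_pos {s : Fin p → Fin n} (hs : Function.Injective s) {a : Fin p}
    (hij : (j : ℕ) = i + 1) (ha : s a = j) (hi : ∀ b, s b ≠ i) :
    0 < vdm (Function.update s a i) * vdm s := by
  have hpos : 0 < ∏ b ∈ univ.erase a, ((s a : ℝ) - s b) * ((i : ℝ) - s b) :=
    prod_pos fun b hb => by
      rw [mul_comm, ha]
      exact sub_mul_sub_pos_of_adjacent hij (hi b) (ha ▸ hs.ne (ne_of_mem_erase hb))
  refine lt_of_le_of_ne ?_ (mul_ne_zero (vdm_ne_zero_iff.2 (injective_update hs hi a))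
    (vdm_ne_zero_iff.2 hs)).symm
  exact nonneg_of_mul_nonneg_left (vdm_update_mul_vdm_nonneg s a i) hpos

namespace FlagNonneg

lemma vdm_mul_flagMinor_update_nonneg (hy : FlagNonneg y) (hp : p ≤ n) {s : Fin p → Fin n}
    (hs : Function.Injective s) {a : Fin p} (hij : (j : ℕ) = i + 1) (ha : s a = j) :
    0 ≤ vdm s * flagMinor hp (Function.update s a i) y := by
  by_cases h : flagMinor hp (Function.update s a i) y = 0
  · rw [h, mul_zero]
  have hi := ne_of_injective_update (injective_of_flagMinor_ne_zero hp h)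
    (ha ▸ Fin.ne_of_gt (Fin.lt_def.2 (by omega)))
  have hpos := vdm_update_mul_vdm_pos hs hij ha hi
  have hsq : 0 < vdm (Function.update s a i) ^ 2 :=
    sq_pos_of_ne_zero (left_ne_zero_of_mul hpos.ne')
  refine nonneg_of_mul_nonneg_right ?_ hsq
  calc 0 ≤ vdm (Function.update s a i) * vdm s *
        (vdm (Function.update s a i) * flagMinor hp (Function.update s a i) y) :=
        mul_nonneg hpos.le (hy.nonneg p hp _)
    _ = _ := by ring

lemma mul_transvection_nonneg (hy : FlagNonneg y) (hij : (j : ℕ) = i + 1) {c : ℝ} (hc : 0 ≤ c)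
    (hp : p ≤ n) (s : Fin p → Fin n) : 0 ≤ vdm s * flagMinor hp s (y * transvection i j c) := by
  by_cases hj : ∀ a, s a ≠ j
  · rw [flagMinor_mul_transvection_of_notMem hp hj]
    exact hy.nonneg p hp s
  push Not at hj
  obtain ⟨a, ha⟩ := hj
  by_cases hs : Function.Injective s
  · rw [flagMinor_mul_transvection hp hs ha, mul_add, mul_left_comm]
    exact add_nonneg (hy.nonneg p hp s)
      (mul_nonneg hc (hy.vdm_mul_flagMinor_update_nonneg hp hs hij ha))
  · rw [not_ne_iff.1 (vdm_ne_zero_iff.not.2 hs), zero_mul]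

lemma flagMinor_mul_transvection_ne_zero_iff (hy : FlagNonneg y) (hij : (j : ℕ) = i + 1) {c : ℝ}
    (hc : 0 < c) (hp : p ≤ n) {s : Fin p → Fin n} (hs : Function.Injective s) :
    flagMinor hp s (y * transvection i j c) ≠ 0 ↔
      flagMinor hp s y ≠ 0 ∨ ∃ a, s a = j ∧ flagMinor hp (Function.update s a i) y ≠ 0 := by
  by_cases hj : ∀ a, s a ≠ j
  · rw [flagMinor_mul_transvection_of_notMem hp hj, or_iff_left]
    rintro ⟨a, ha, -⟩
    exact hj a ha
  push Not at hj
  obtain ⟨a, ha⟩ := hj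
  have hex : (∃ b, s b = j ∧ flagMinor hp (Function.update s b i) y ≠ 0) ↔
      flagMinor hp (Function.update s a i) y ≠ 0 := by
    refine ⟨?_, fun h => ⟨a, ha, h⟩⟩
    rintro ⟨b, hb, h⟩
    rwa [← hs (hb.trans ha.symm)]
  have hv := vdm_ne_zero_iff.2 hs
  have hsum := add_eq_zero_iff_of_nonneg (hy.nonneg p hp s)
    (mul_nonneg hc.le (hy.vdm_mul_flagMinor_update_nonneg hp hs hij ha))
  rw [mul_left_comm c, ← mul_add] at hsum
  simp only [mul_eq_zero, hv, hc.ne', false_or] at hsum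
  rw [hex, flagMinor_mul_transvection hp hs ha, Ne, hsum, not_and_or]

lemma mul_transvection (hy : FlagNonneg y) (hij : (j : ℕ) = i + 1) {c : ℝ} (hc : 0 ≤ c) :
    FlagNonneg (y * transvection i j c) := by
  obtain rfl | hc := hc.eq_or_lt
  · rwa [transvection_zero, mul_one]
  refine ⟨fun p hp s => hy.mul_transvection_nonneg hij hc.le hp s, fun p hp s t ht hts h => ?_⟩
  have hs := injective_of_flagMinor_ne_zero hp h
  rw [hy.flagMinor_mul_transvection_ne_zero_iff hij hc hp ht]
  obtain h | ⟨a, ha, h⟩ := (hy.flagMinor_mul_transvection_ne_zero_iff hij hc hp hs).1 h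
  · exact .inl (hy.down p hp s t ht hts h)
  have hi := ne_of_injective_update (injective_of_flagMinor_ne_zero hp h)
    (ha ▸ Fin.ne_of_gt (Fin.lt_def.2 (by omega)))
  obtain hle | ⟨b, hb, hti, hle⟩ := hts.exchange hij ha hi
  · exact .inl (hy.down p hp _ t ht hle h)
  · exact .inr ⟨b, hb, hy.down p hp _ _ (injective_update ht hti b) hle h⟩

end FlagNonneg

lemma flagNonneg_of_mem_Y (hx : x ∈ Y n) : FlagNonneg x := by
  induction hx using Submonoid.closure_induction_right with
  | one => exact flagNonneg_one
  | mul_right y _ z hz hy =>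
    obtain ⟨i, h, t, ht, rfl⟩ := hz
    exact hy.mul_transvection rfl ht

lemma mem_N_of_mem_Y (hx : x ∈ Y n) : x ∈ N n := by
  suffices h : Y n ≤ unitriangular ℝ id from mem_N_iff.2 (h hx)
  refine (Submonoid.closure_le).2 ?_
  rintro _ ⟨i, h, t, -, rfl⟩ k l hlk
  have hne : ¬ (i = k ∧ (⟨i + 1, h⟩ : Fin n) = l) := by
    rintro ⟨rfl, rfl⟩
    exact (Nat.lt_succ_self _).not_ge hlk
  rw [transvection, Matrix.add_apply, single_apply, if_neg hne, add_zero]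

end FlagNonneg

section BruhatCell

variable {n p : ℕ} (hp : p ≤ n) {u v w : Equiv.Perm (Fin n)} {x : Mat n} {s : Fin p → Fin n}

/-- The sequence of columns `w⁻¹ 0, …, w⁻¹ (p - 1)`, on which the flag minor of `perm w` is `1`. -/
def initialSeq (w : Equiv.Perm (Fin n)) (hp : p ≤ n) : Fin p → Fin n :=
  ⇑w⁻¹ ∘ Fin.castLE hp

lemma initialSeq_injective (w : Equiv.Perm (Fin n)) : Function.Injective (initialSeq w hp) :=
  w⁻¹.injective.comp (Fin.castLE_injective hp)

lemma apply_initialSeq (w : Equiv.Perm (Fin n)) (a : Fin p) :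
    w (initialSeq w hp a) = Fin.castLE hp a :=
  w.apply_symm_apply _

lemma initialSeq_mk {i : Fin n} (hi : (w i : ℕ) < p) : initialSeq w hp ⟨w i, hi⟩ = i :=
  w.symm_apply_apply i

lemma image_initialSeq (w : Equiv.Perm (Fin n)) :
    univ.image (initialSeq w hp) = ({i | (w i : ℕ) < p} : Finset (Fin n)) := by
  ext i
  simp only [mem_image, mem_univ, true_and, mem_filter]
  refine ⟨?_, fun hi => ⟨⟨w i, hi⟩, initialSeq_mk hp hi⟩⟩
  rintro ⟨a, rfl⟩
  rw [apply_initialSeq]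
  exact a.2

lemma flagMinor_perm_mul (w : Equiv.Perm (Fin n)) (s : Fin p → Fin n) (y : Mat n) :
    flagMinor hp s (perm w * y) = (y.submatrix (initialSeq w hp) s).det := by
  rw [flagMinor]
  congr 1
  ext i j
  rw [submatrix_apply, perm_mul_apply, submatrix_apply]
  rfl

lemma flagMinor_initialSeq_ne_zero (hx : x ∈ bruhatCell w) :
    flagMinor hp (initialSeq w hp) x ≠ 0 := by
  obtain ⟨c, hc, d, hd, rfl⟩ := hx
  rw [mul_assoc, flagMinor_lower_mul hp _ (mem_Bminus_iff.1 hc).1, flagMinor_perm_mul]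
  refine mul_ne_zero (flagMinor_castLE_ne_zero_of_mem_Bminus hp hc) ?_
  rw [det_of_blockTriangular_injective
    (OrderDual.toDual.injective.comp (initialSeq_injective hp w))
    (mem_Bminus_iff.1 hd).1.submatrix]
  exact prod_ne_zero_iff.2 fun i _ => hd.2 _

lemma galeLE_initialSeq_of_flagMinor_ne_zero (hx : x ∈ bruhatCell w) (h : flagMinor hp s x ≠ 0) :
    GaleLE s (initialSeq w hp) := by
  obtain ⟨c, hc, d, hd, rfl⟩ := hx
  rw [mul_assoc, flagMinor_lower_mul hp _ (mem_Bminus_iff.1 hc).1, flagMinor_perm_mul] at h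
  have hdet := right_ne_zero_of_mul h
  rw [det_apply] at hdet
  obtain ⟨σ, -, hσ⟩ := exists_ne_zero_of_sum_ne_zero hdet
  have hentry (a : Fin p) : d (initialSeq w hp (σ a)) (s a) ≠ 0 := fun h0 => hσ <| by
    rw [prod_eq_zero (mem_univ a) h0, smul_zero]
  refine fun j => card_le_card_of_injOn σ (fun a ha => ?_) σ.injective.injOn
  rw [coe_filter_univ, Set.mem_ofPred_eq] at ha ⊢
  refine ha.trans ?_
  by_contra! hlt
  exact hentry a (hd.1 _ _ hlt)

lemma perm_mem_bruhatCell (w : Equiv.Perm (Fin n)) : perm w ∈ bruhatCell w :=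
  ⟨1, one_mem_Bminus, 1, one_mem_Bminus, by rw [one_mul, mul_one]⟩

lemma galeLE_initialSeq_of_bruhatLE (h : bruhatLE u v) :
    GaleLE (initialSeq u hp) (initialSeq v hp) := by
  by_contra hlt
  have hsub : bruhatCell v ⊆ {x | flagMinor hp (initialSeq u hp) x = 0} := by
    intro x hx
    by_contra h0
    exact hlt (galeLE_initialSeq_of_flagMinor_ne_zero hp hx h0)
  have hclosed : IsClosed {x | flagMinor hp (initialSeq u hp) x = 0} :=
    isClosed_eq (continuous_flagMinor hp _) continuous_const
  exact flagMinor_initialSeq_ne_zero hp (perm_mem_bruhatCell u)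
    (closure_minimal hsub hclosed (h (perm_mem_bruhatCell u)))

lemma flagMinor_initialSeq_ne_zero_of_mem_Ygeq (hx : x ∈ Ygeq u) :
    flagMinor hp (initialSeq u hp) x ≠ 0 := by
  obtain ⟨v, huv, hxY, hxv⟩ := hx
  exact (flagNonneg_of_mem_Y hxY).down p hp _ _ (initialSeq_injective hp u)
    (galeLE_initialSeq_of_bruhatLE hp huv) (flagMinor_initialSeq_ne_zero hp hxv)

end BruhatCell

section ExchangeCoeff

lemma unitriangular.det_submatrix_update {m m' α R : Type*} [Fintype m] [DecidableEq m] [Fintype m']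
    [DecidableEq m'] [LinearOrder α] [CommRing R] {b : m → α} {g : Matrix m m R}
    (hg : g ∈ unitriangular R b) {e : m' → m} (he : Function.Injective e)
    (hlower : ∀ d k, b k < b (e d) → k ∈ Set.range e) (a : m') (j : m) :
    (g.submatrix e (Function.update e a j)).det = ∑ d, g⁻¹ (e a) (e d) * g (e d) j := by
  have hdet : (g.submatrix e e).det = 1 :=
    unitriangular.det_eq_one (unitriangular.submatrix he hg)
  have hinv : g⁻¹.submatrix e e * g.submatrix e e = 1 := by
    rw [← submatrix_one e he, ← nonsing_inv_mul g (unitriangular.isUnit_det hg)]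
    ext c d
    rw [mul_apply, submatrix_apply, mul_apply]
    refine Fintype.sum_of_injective e he _ _ (fun k hk => ?_) fun k => rfl
    have hkd : b (e d) ≤ b k := le_of_not_gt fun h => hk (hlower d k h)
    rw [hg k (e d) hkd, one_apply_ne (fun h => hk ⟨d, h.symm⟩), mul_zero]
  have hupd : g.submatrix e (Function.update e a j)
      = (g.submatrix e e).updateCol a fun d => g (e d) j := by
    ext c d
    rw [updateCol_apply, submatrix_apply, submatrix_apply, Function.update_apply,
      apply_ite (g (e c))]
  rw [hupd, ← cramer_apply, ← det_smul_inv_mulVec_eq_cramer _ _ (hdet ▸ isUnit_one), hdet, one_smul,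
    inv_eq_left_inv hinv]
  rfl

variable {n : ℕ} {u : Equiv.Perm (Fin n)} {x c g : Mat n} {i j k q r : Fin n} {p : ℕ}

/-- For `x = c * perm u * g` with `c` lower triangular and `g` unitriangular for `u`, this is the
ratio of the flag minor of `x` on the columns `u⁻¹ 0, …, u⁻¹ (p - 1)` with `i` replaced by `j` to
that on `u⁻¹ 0, …, u⁻¹ (p - 1)`. -/
def exchangeCoeff (u : Equiv.Perm (Fin n)) (g : Mat n) (p : ℕ) (i j : Fin n) : ℝ :=
  ∑ k with (u k : ℕ) < p, g⁻¹ i k * g k j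

lemma exchangeCoeff_succ (hg : g ∈ unitriangular ℝ u) (i j : Fin n) :
    exchangeCoeff u g (u i + 1) i j = g i j := by
  have hinv := unitriangular.inv_mem hg
  rw [exchangeCoeff, sum_eq_single_of_mem i (by simp), unitriangular.diag hinv, one_mul]
  intro k hk hki
  rw [mem_filter_univ, Nat.lt_succ_iff] at hk
  rw [hinv i k (Fin.le_def.2 hk), one_apply_ne hki.symm, zero_mul]

lemma exchangeCoeff_val (hg : g ∈ unitriangular ℝ u) (hij : i ≠ j) :
    exchangeCoeff u g (u j) i j = -g⁻¹ i j := by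
  have hsum : ∑ k, g⁻¹ i k * g k j = 0 := by
    rw [← mul_apply, nonsing_inv_mul _ (unitriangular.isUnit_det hg), one_apply_ne hij]
  have hrest : ∑ k with ¬(u k : ℕ) < u j, g⁻¹ i k * g k j = g⁻¹ i j := by
    rw [sum_eq_single_of_mem j (by simp), unitriangular.diag hg, mul_one]
    intro k hk hkj
    rw [mem_filter_univ, not_lt] at hk
    rw [hg k j (Fin.le_def.2 hk), one_apply_ne hkj, mul_zero]
  rwa [← sum_filter_add_sum_filter_not univ (fun k => (u k : ℕ) < u j), hrest,
    ← eq_neg_iff_add_eq_zero] at hsum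

lemma exchangeCoeff_self (hg : g ∈ unitriangular ℝ u) (hi : (u i : ℕ) < p) :
    exchangeCoeff u g p i i = 1 := by
  have hinv := unitriangular.inv_mem hg
  rw [exchangeCoeff, sum_eq_single_of_mem i (by simpa using hi), unitriangular.diag hinv,
    unitriangular.diag hg, mul_one]
  intro k _ hki
  obtain h | h := le_total (u k) (u i)
  · rw [hinv i k h, one_apply_ne hki.symm, zero_mul]
  · rw [hg k i h, one_apply_ne hki, mul_zero]

/-- A factorization `x = c u g` of a totally nonnegative matrix `x ∈ Y_{≥ u}`, with `c` in `B₋` and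
`g` in `u⁻¹ N u`. -/
structure CellFactor (u : Equiv.Perm (Fin n)) (x c g : Mat n) : Prop where
  flag : FlagNonneg x
  lower : c ∈ Bminus n
  upper : g ∈ unitriangular ℝ u
  eq_mul : x = c * perm u * g

lemma exists_cellFactor (hx : x ∈ Ygeq u) : ∃ c g, CellFactor u x c g := by
  obtain ⟨c, hc, a, ha, hxa⟩ := exists_Bminus_mul_N (x := x * perm u⁻¹) fun p hp => by
    rw [flagMinor_mul_perm]
    exact flagMinor_initialSeq_ne_zero_of_mem_Ygeq hp hx
  refine ⟨c, perm u⁻¹ * a * perm u, flagNonneg_of_mem_Y hx.choose_spec.2.1, hc,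
    perm_inv_conj_mem_unitriangular ha, ?_⟩
  calc x = x * perm u⁻¹ * perm u := by rw [mul_assoc, perm_inv_mul_perm, mul_one]
    _ = c * (perm u * perm u⁻¹) * a * perm u := by rw [hxa, perm_mul_perm_inv, mul_one]
    _ = _ := by simp only [mul_assoc]

namespace CellFactor

lemma flagMinor_initialSeq_ne_zero (h : CellFactor u x c g) (hp : p ≤ n) :
    flagMinor hp (initialSeq u hp) x ≠ 0 := by
  rw [h.eq_mul, mul_assoc, flagMinor_lower_mul hp _ (mem_Bminus_iff.1 h.lower).1,
    flagMinor_perm_mul, unitriangular.det_eq_one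
      (unitriangular.submatrix (initialSeq_injective hp u) h.upper), mul_one]
  exact flagMinor_castLE_ne_zero_of_mem_Bminus hp h.lower

lemma flagMinor_update (h : CellFactor u x c g) (hp : p ≤ n) (hi : (u i : ℕ) < p) (j : Fin n) :
    flagMinor hp (Function.update (initialSeq u hp) ⟨u i, hi⟩ j) x
      = flagMinor hp (initialSeq u hp) x * exchangeCoeff u g p i j := by
  have hs := initialSeq_injective hp u
  have hlower (d : Fin p) (k : Fin n) (hk : u k < u (initialSeq u hp d)) :
      k ∈ Set.range (initialSeq u hp) := by
    rw [apply_initialSeq] at hk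
    exact ⟨⟨u k, (Fin.lt_def.1 hk).trans d.2⟩, initialSeq_mk hp _⟩
  rw [h.eq_mul, mul_assoc, flagMinor_lower_mul hp _ (mem_Bminus_iff.1 h.lower).1,
    flagMinor_lower_mul hp _ (mem_Bminus_iff.1 h.lower).1, flagMinor_perm_mul, flagMinor_perm_mul,
    unitriangular.det_submatrix_update h.upper hs hlower,
    unitriangular.det_eq_one (unitriangular.submatrix hs h.upper), mul_one, exchangeCoeff,
    ← image_initialSeq hp, sum_image hs.injOn, initialSeq_mk]

lemma exchangeCoeff_mul_prod_nonneg (h : CellFactor u x c g) (hp : p ≤ n) (hi : (u i : ℕ) < p)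
    (j : Fin n) : 0 ≤ exchangeCoeff u g p i j *
      ∏ k ∈ ({k | (u k : ℕ) < p} : Finset (Fin n)).erase i, ((i : ℝ) - k) * ((j : ℝ) - k) := by
  by_cases h0 : exchangeCoeff u g p i j = 0
  · rw [h0, zero_mul]
  have hs := initialSeq_injective hp u
  have hF := h.flagMinor_initialSeq_ne_zero hp
  have hV := vdm_ne_zero_iff.2 hs
  have hV' := vdm_ne_zero_iff.2 (injective_of_flagMinor_ne_zero (x := x) hp
    (h.flagMinor_update hp hi j ▸ mul_ne_zero hF h0))
  have hbase := h.flag.nonneg p hp (initialSeq u hp)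
  have hupd := h.flag.nonneg p hp (Function.update (initialSeq u hp) ⟨u i, hi⟩ j)
  have hsign := vdm_update_mul_vdm_nonneg (initialSeq u hp) ⟨u i, hi⟩ j
  rw [h.flagMinor_update] at hupd
  rw [initialSeq_mk] at hsign
  have herase : ({k | (u k : ℕ) < p} : Finset (Fin n)).erase i
      = (univ.erase ⟨u i, hi⟩).image (initialSeq u hp) := by
    rw [image_erase hs, image_initialSeq, initialSeq_mk]
  rw [herase, prod_image hs.injOn]
  have hsq := mul_pos (sq_pos_of_ne_zero (mul_ne_zero hV' hV)) (sq_pos_of_ne_zero hF)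
  refine nonneg_of_mul_nonneg_right ?_ hsq
  calc 0 ≤ _ := mul_nonneg (mul_nonneg hsign hbase) hupd
    _ = _ := by ring

lemma exchangeCoeff_ne_zero_of_le (h : CellFactor u x c g) (hp : p ≤ n) (hi : (u i : ℕ) < p)
    (hj : p ≤ (u j : ℕ)) (hjk : j ≤ k) (hk : exchangeCoeff u g p i k ≠ 0) :
    exchangeCoeff u g p i j ≠ 0 := by
  have hne (a : Fin p) : initialSeq u hp a ≠ j := by
    rintro rfl
    rw [apply_initialSeq] at hj
    exact a.2.not_ge hj
  have hgale : GaleLE (Function.update (initialSeq u hp) ⟨u i, hi⟩ j)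
      (Function.update (initialSeq u hp) ⟨u i, hi⟩ k) :=
    galeLE_of_le (update_le_update_iff'.2 hjk)
  have := h.flag.down p hp _ _ (injective_update (initialSeq_injective hp u) hne _) hgale
  rw [h.flagMinor_update, h.flagMinor_update] at this
  exact right_ne_zero_of_mul (this (mul_ne_zero (h.flagMinor_initialSeq_ne_zero hp) hk))

lemma apply_ne_zero_of_le (h : CellFactor u x c g) (hij : u i < u j) (hjk : j ≤ k)
    (hk : g i k ≠ 0) : g i j ≠ 0 := by
  rw [← exchangeCoeff_succ h.upper] at hk ⊢
  exact h.exchangeCoeff_ne_zero_of_le (Nat.succ_le_of_lt (u i).2) (Nat.lt_succ_self _)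
    (Nat.succ_le_of_lt hij) hjk hk

lemma inv_apply_ne_zero (h : CellFactor u x c g) (hij : u i < u j) (hji : j ≤ i) :
    g⁻¹ i j ≠ 0 := by
  rw [← neg_ne_zero, ← exchangeCoeff_val h.upper (ne_of_apply_ne u hij.ne)]
  refine h.exchangeCoeff_ne_zero_of_le (u j).2.le hij le_rfl hji ?_
  rw [exchangeCoeff_self h.upper hij]
  exact one_ne_zero

lemma apply_eq_zero_of_mem_bruhatCell (h : CellFactor u x c g) (hx : x ∈ bruhatCell u)
    (hij : i < j) : g i j = 0 := by
  by_contra hne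
  rw [← exchangeCoeff_succ h.upper] at hne
  have hp := Nat.succ_le_of_lt (u i).2
  have hminor := h.flagMinor_update hp (Nat.lt_succ_self _) j ▸
    mul_ne_zero (h.flagMinor_initialSeq_ne_zero hp) hne
  have hle := galeLE_initialSeq_of_flagMinor_ne_zero hp hx hminor j
  have hadd := countGE_update_add (initialSeq u hp) ⟨u i, Nat.lt_succ_self _⟩ j j
  rw [initialSeq_mk, if_neg (Fin.lt_def.1 hij).not_ge, if_pos le_rfl] at hadd
  omega

end CellFactor

end ExchangeCoeff

section Positivity

variable {n : ℕ} {u : Equiv.Perm (Fin n)} {x c g : Mat n} {i j q r : Fin n}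

/-- The diagonal matrix with entries `0, -1, …, -(n - 1)`. Up to a scalar matrix it is the
derivative of `torus n τ` at `τ = 1`. -/
def weight (n : ℕ) : Mat n :=
  diagonal fun i => -(i : ℝ)

namespace CellFactor

lemma apply_nonneg_of_adjacent (h : CellFactor u x c g) (hqr : (r : ℕ) = q + 1) : 0 ≤ g q r := by
  obtain hle | hlt := le_or_gt (u r) (u q)
  · rw [h.upper q r hle, one_apply_ne (by rintro rfl; omega)]
  · have hsign := h.exchangeCoeff_mul_prod_nonneg (Nat.succ_le_of_lt (u q).2)
      (Nat.lt_succ_self _) r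
    rw [exchangeCoeff_succ h.upper] at hsign
    refine nonneg_of_mul_nonneg_left hsign (prod_pos fun k hk => ?_)
    refine sub_mul_sub_pos_of_adjacent hqr (ne_of_mem_erase hk) ?_
    rintro rfl
    rw [mem_erase, mem_filter_univ] at hk
    exact (Nat.lt_succ_iff.1 hk.2).not_gt hlt

lemma inv_apply_nonpos_of_adjacent (h : CellFactor u x c g) (hqr : (r : ℕ) = q + 1) :
    g⁻¹ q r ≤ 0 := by
  have hne : q ≠ r := by
    rintro rfl
    omega
  obtain hle | hlt := le_or_gt (u r) (u q)
  · rw [unitriangular.inv_mem h.upper q r hle, one_apply_ne hne]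
  · have hsign := h.exchangeCoeff_mul_prod_nonneg (u r).2.le hlt r
    rw [exchangeCoeff_val h.upper hne] at hsign
    refine neg_nonneg.1 (nonneg_of_mul_nonneg_left hsign (prod_pos fun k hk => ?_))
    refine sub_mul_sub_pos_of_adjacent hqr (ne_of_mem_erase hk) ?_
    rintro rfl
    rw [mem_erase, mem_filter_univ] at hk
    exact hk.2.false

lemma inv_apply_mul_apply_mul_sub_nonneg (h : CellFactor u x c g) (hqr : (r : ℕ) = q + 1)
    (hqi : u q < u i) (hir : u i < u r) : 0 ≤ g⁻¹ q i * g i r * ((q : ℝ) - i) := by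
  have hinv_sign := h.exchangeCoeff_mul_prod_nonneg (u i).2.le hqi i
  have hsign := h.exchangeCoeff_mul_prod_nonneg (p := u i + 1) (Nat.succ_le_of_lt (u i).2)
    (Nat.lt_succ_self _) r
  have herase : ({k | (u k : ℕ) < u i + 1} : Finset (Fin n)).erase i
      = ({k | (u k : ℕ) < u i} : Finset (Fin n)) := by
    ext k
    rw [mem_erase, mem_filter_univ, mem_filter_univ, ← u.injective.ne_iff, Fin.ne_iff_vne]
    omega
  rw [exchangeCoeff_val h.upper (ne_of_apply_ne u hqi.ne)] at hinv_sign
  rw [exchangeCoeff_succ h.upper, herase,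
    ← mul_prod_erase _ _ ((mem_filter_univ q).2 (Fin.lt_def.1 hqi)),
    show (r : ℝ) - q = 1 by rw [hqr]; push_cast; ring] at hsign
  have hpos : 0 < ∏ k ∈ ({k | (u k : ℕ) < u i} : Finset (Fin n)).erase q,
      (((q : ℝ) - k) * ((i : ℝ) - k)) * (((i : ℝ) - k) * ((r : ℝ) - k)) := by
    refine prod_pos fun k hk => ?_
    rw [mem_erase, mem_filter_univ] at hk
    have hkr : k ≠ r := by
      rintro rfl
      exact hk.2.not_gt hir
    have hik : (i : ℝ) - k ≠ 0 := by
      rw [sub_ne_zero, Nat.cast_injective.ne_iff, ← Fin.ne_iff_vne]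
      rintro rfl
      exact hk.2.false
    have := mul_pos (sub_mul_sub_pos_of_adjacent hqr hk.1 hkr) (sq_pos_of_ne_zero hik)
    linarith
  refine nonneg_of_mul_nonneg_left ?_ hpos
  rw [prod_mul_distrib]
  linarith [mul_nonneg hinv_sign hsign]

lemma inv_apply_mul_apply_mul_nonneg (h : CellFactor u x c g) (hqr : (r : ℕ) = q + 1) (i : Fin n) :
    0 ≤ g⁻¹ q i * g i r * ((q : ℝ) + 1 / 2 - i) := by
  have hinv := unitriangular.inv_mem h.upper
  obtain rfl | hqi := eq_or_ne q i
  · rw [unitriangular.diag hinv, one_mul]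
    exact mul_nonneg (h.apply_nonneg_of_adjacent hqr) (by linarith)
  obtain rfl | hir := eq_or_ne i r
  · rw [unitriangular.diag h.upper, mul_one]
    exact mul_nonneg_of_nonpos_of_nonpos (h.inv_apply_nonpos_of_adjacent hqr)
      (by rw [hqr]; push_cast; linarith)
  obtain hle | hlt := le_or_gt (u i) (u q)
  · rw [hinv q i hle, one_apply_ne hqi, zero_mul, zero_mul]
  obtain hle' | hlt' := le_or_gt (u r) (u i)
  · rw [h.upper i r hle', one_apply_ne hir, mul_zero, zero_mul]
  have hterm := h.inv_apply_mul_apply_mul_sub_nonneg hqr hlt hlt'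
  rw [Fin.ne_iff_vne] at hqi
  obtain hqi | hqi := hqi.lt_or_gt
  · have hle : (q : ℝ) + 1 ≤ i := mod_cast hqi
    exact mul_nonneg_of_nonpos_of_nonpos
      (nonpos_of_mul_nonneg_left hterm (by linarith)) (by linarith)
  · have hle : (i : ℝ) + 1 ≤ q := mod_cast hqi
    exact mul_nonneg (nonneg_of_mul_nonneg_left hterm (by linarith)) (by linarith)

lemma exists_inv_apply_mul_apply_ne_zero (h : CellFactor u x c g) (hij : i < j)
    (hg : g i j ≠ 0) : ∃ q r : Fin n, (r : ℕ) = q + 1 ∧ g⁻¹ q i * g i r ≠ 0 := by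
  have huij : u i < u j := not_le.1 fun hle => hg (by rw [h.upper i j hle, one_apply_ne hij.ne])
  let S : Finset (Fin n) := {k | i < k ∧ u i < u k}
  have hS : j ∈ S := by simp [S, hij, huij]
  obtain ⟨r, hr, hmin⟩ := S.exists_min_image id ⟨j, hS⟩
  obtain ⟨hir, huir⟩ := (mem_filter_univ r).1 hr
  have hr_pos : (r : ℕ) - 1 + 1 = r := by omega
  refine ⟨⟨r - 1, by omega⟩, r, hr_pos.symm,
    mul_ne_zero ?_ (h.apply_ne_zero_of_le huir (hmin j hS) hg)⟩
  generalize hq : (⟨r - 1, by omega⟩ : Fin n) = q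
  have hqr : q < r := by
    rw [← hq, Fin.lt_def]
    exact Nat.pred_lt_of_lt hir
  obtain rfl | hiq := (show i ≤ q by rw [← hq, Fin.le_def]; exact Nat.le_pred_of_lt hir).eq_or_lt
  · rw [unitriangular.diag (unitriangular.inv_mem h.upper)]
    exact one_ne_zero
  · refine h.inv_apply_ne_zero (lt_of_le_of_ne (not_lt.1 fun hlt => ?_) (u.injective.ne hiq.ne'))
      hiq.le
    exact (hmin q (by simp [S, hiq, hlt])).not_gt hqr

-- Since `∑ i, g⁻¹ q i * g i r = 0`, any constant may be added to the weights; adding `q + 1 / 2`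
-- makes every summand nonnegative when `r = q + 1`.
lemma inv_mul_weight_mul_apply (h : CellFactor u x c g) (hqr : q ≠ r) :
    (g⁻¹ * weight n * g) q r = ∑ i, g⁻¹ q i * g i r * ((q : ℝ) + 1 / 2 - i) := by
  have hsum : ∑ i, g⁻¹ q i * g i r = 0 := by
    rw [← mul_apply, nonsing_inv_mul _ (unitriangular.isUnit_det h.upper), one_apply_ne hqr]
  rw [weight, mul_apply, ← sub_eq_zero, ← sum_sub_distrib,
    ← mul_zero (-((q : ℝ) + 1 / 2)), ← hsum, mul_sum]
  refine sum_congr rfl fun i _ => ?_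
  rw [mul_diagonal]
  ring

lemma str_inv_mul_weight_mul_pos (h : CellFactor u x c g) (hij : i < j) (hg : g i j ≠ 0) :
    0 < str (g⁻¹ * weight n * g) := by
  have hterm (q : Fin n) (hq : q.val + 1 < n) :=
    h.inv_apply_mul_apply_mul_nonneg (r := ⟨q.val + 1, hq⟩) rfl
  have hentry (q : Fin n) (hq : q.val + 1 < n) := h.inv_mul_weight_mul_apply (q := q)
    (r := ⟨q.val + 1, hq⟩) (Fin.ne_of_lt (Nat.lt_succ_self _))
  refine sum_pos' (fun q _ => ?_) ?_
  · split_ifs with hq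
    · rw [hentry q hq]
      exact sum_nonneg fun k _ => hterm q hq k
    · exact le_rfl
  · obtain ⟨q, r, hqr, hne⟩ := h.exists_inv_apply_mul_apply_ne_zero hij hg
    have hq : q.val + 1 < n := hqr ▸ r.2
    obtain rfl : r = ⟨q.val + 1, hq⟩ := Fin.ext hqr
    refine ⟨q, mem_univ q, ?_⟩
    rw [dif_pos hq, hentry q hq]
    refine sum_pos' (fun k _ => hterm q hq k)
      ⟨i, mem_univ i, (hterm q hq i).lt_of_ne' (mul_ne_zero hne ?_)⟩
    rw [sub_ne_zero, ne_comm]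
    intro hhalf
    have hodd : 2 * (i : ℝ) = 2 * q + 1 := by linarith
    norm_cast at hodd
    omega

end CellFactor

end Positivity

section Torus

variable {n : ℕ} {τ : ℝ} {u : Equiv.Perm (Fin n)} {x c : Mat n}

lemma torus_eq_diagonal (τ : ℝ) : torus n τ =
    diagonal fun i : Fin n => τ ^ (-((n : ℝ) - 1) / 2) * τ ^ (n - 1 - i.val) := by
  rw [torus, ← diagonal_smul]
  rfl

lemma torus_apply_self_ne_zero (hτ : 0 < τ) (i : Fin n) : torus n τ i i ≠ 0 := by
  rw [torus_eq_diagonal, diagonal_apply_eq]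
  exact mul_ne_zero (Real.rpow_pos_of_pos hτ _).ne' (pow_ne_zero _ hτ.ne')

lemma torus_mem_Bminus (hτ : 0 < τ) : torus n τ ∈ Bminus n :=
  ⟨fun i j hij => by rw [torus_eq_diagonal, diagonal_apply_ne _ hij.ne],
    torus_apply_self_ne_zero hτ⟩

lemma isUnit_det_torus (hτ : 0 < τ) : IsUnit (torus n τ).det :=
  (mem_Bminus_iff.1 (torus_mem_Bminus hτ)).2

lemma scale_mul (hτ : 0 < τ) (x y : Mat n) : scale τ (x * y) = scale τ x * scale τ y := by
  simp only [scale, mul_assoc]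
  rw [nonsing_inv_mul_cancel_left _ _ (isUnit_det_torus hτ)]

lemma scale_map_one (hτ : 0 < τ) : scale τ (1 : Mat n) = 1 := by
  rw [scale, mul_one, mul_nonsing_inv _ (isUnit_det_torus hτ)]

lemma scale_inv (hτ : 0 < τ) (hx : IsUnit x.det) : scale τ x⁻¹ = (scale τ x)⁻¹ :=
  (inv_eq_left_inv (by rw [← scale_mul hτ, nonsing_inv_mul _ hx, scale_map_one hτ])).symm

lemma scale_apply (hτ : 0 < τ) (x : Mat n) (i j : Fin n) :
    scale τ x i j = τ ^ ((j : ℤ) - i) * x i j := by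
  have hmul : scale τ x * torus n τ = torus n τ * x := by
    rw [scale, nonsing_inv_mul_cancel_right _ _ (isUnit_det_torus hτ)]
  have hentry := congrFun (congrFun hmul i) j
  have hpow : τ ^ (n - 1 - i.val) = τ ^ ((j : ℤ) - i) * τ ^ (n - 1 - j.val) := by
    rw [← zpow_natCast, ← zpow_natCast, ← zpow_add₀ hτ.ne']
    congr 1
    omega
  refine mul_right_cancel₀ (torus_apply_self_ne_zero hτ j) ?_
  rw [torus_eq_diagonal, mul_diagonal, diagonal_mul] at hentry
  rw [torus_eq_diagonal, diagonal_apply_eq, hentry, hpow]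
  ring

lemma scale_one (x : Mat n) : scale 1 x = x := by
  ext i j
  rw [scale_apply one_pos, _root_.one_zpow, one_mul]

lemma scale_mem_unitriangular {α : Type*} [LinearOrder α] {b : Fin n → α} (hτ : 0 < τ)
    (hx : x ∈ unitriangular ℝ b) : scale τ x ∈ unitriangular ℝ b := fun i j hij => by
  rw [← scale_map_one hτ, scale_apply hτ, scale_apply hτ, hx i j hij]

lemma scale_transvection (hτ : 0 < τ) (i j : Fin n) (t : ℝ) :
    scale τ (transvection i j t) = transvection i j (τ ^ ((j : ℤ) - i) * t) := by
  ext k l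
  rw [scale_apply hτ, transvection, transvection, Matrix.add_apply, Matrix.add_apply, mul_add,
    ← scale_apply hτ, scale_map_one hτ, single_apply, single_apply]
  split_ifs with hkl
  · rw [hkl.1, hkl.2]
  · rw [mul_zero]

lemma scale_mem_Y (hτ : 0 < τ) (hx : x ∈ Y n) : scale τ x ∈ Y n := by
  induction hx using Submonoid.closure_induction with
  | mem x hx =>
    obtain ⟨i, hi, t, ht, rfl⟩ := hx
    rw [scale_transvection hτ]
    exact Submonoid.subset_closure ⟨i, hi, _, mul_nonneg (zpow_pos hτ _).le ht, rfl⟩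
  | one =>
    rw [scale_map_one hτ]
    exact one_mem _
  | mul x y _ _ hx hy =>
    rw [scale_mul hτ]
    exact mul_mem hx hy

lemma scale_mem_bruhatCell (hτ : 0 < τ) (hx : x ∈ bruhatCell u) : scale τ x ∈ bruhatCell u := by
  obtain ⟨c, hc, c', hc', rfl⟩ := hx
  have ht := torus_mem_Bminus (n := n) hτ
  refine ⟨_, mul_mem_Bminus ht hc, _, mul_mem_Bminus hc' (inv_mem_Bminus ht), ?_⟩
  rw [scale]
  simp only [mul_assoc]

lemma scale_mem_Ygeq (hτ : 0 < τ) (hx : x ∈ Ygeq u) : scale τ x ∈ Ygeq u := by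
  obtain ⟨v, huv, hxY, hxv⟩ := hx
  exact ⟨v, huv, scale_mem_Y hτ hxY, scale_mem_bruhatCell hτ hxv⟩

lemma scale_mem_Bminus (hτ : 0 < τ) (hc : c ∈ Bminus n) : scale τ c ∈ Bminus n :=
  mul_mem_Bminus (mul_mem_Bminus (torus_mem_Bminus hτ) hc) (inv_mem_Bminus (torus_mem_Bminus hτ))

lemma scale_perm_mul_perm_inv_mem_Bminus (hτ : 0 < τ) (u : Equiv.Perm (Fin n)) :
    scale τ (perm u) * perm u⁻¹ ∈ Bminus n := by
  have hentry (i j : Fin n) : (scale τ (perm u) * perm u⁻¹) i j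
      = τ ^ (((u⁻¹ j : Fin n) : ℤ) - i) * (1 : Mat n) i j := by
    rw [← perm_mul_perm_inv u, mul_perm_apply, mul_perm_apply, scale_apply hτ]
  refine ⟨fun i j hij => ?_, fun i => ?_⟩
  · rw [hentry, one_apply_ne hij.ne, mul_zero]
  · rw [hentry, one_apply_eq, mul_one]
    exact zpow_ne_zero _ hτ.ne'

lemma exists_scale_mul_perm_mul (hτ : 0 < τ) (hc : c ∈ Bminus n) (u : Equiv.Perm (Fin n))
    (g : Mat n) : ∃ c' ∈ Bminus n, scale τ (c * perm u * g) = c' * perm u * scale τ g := by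
  refine ⟨scale τ c * (scale τ (perm u) * perm u⁻¹), mul_mem_Bminus (scale_mem_Bminus hτ hc)
    (scale_perm_mul_perm_inv_mem_Bminus hτ u), ?_⟩
  calc scale τ (c * perm u * g) = scale τ c * scale τ (perm u) * 1 * scale τ g := by
        rw [scale_mul hτ, scale_mul hτ, mul_one]
    _ = _ := by
        rw [← perm_inv_mul_perm u]
        simp only [mul_assoc]

end Torus

section Fiber

variable {n : ℕ} {u : Equiv.Perm (Fin n)} {xu x X c c' g G l z m w : Mat n} {τ : ℝ}

lemma perm_inv_conj_perm_conj (u : Equiv.Perm (Fin n)) (g : Mat n) :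
    perm u⁻¹ * (perm u * g * perm u⁻¹) * perm u = g := by
  calc _ = (perm u⁻¹ * perm u) * g * (perm u⁻¹ * perm u) := by simp only [mul_assoc]
    _ = g := by rw [perm_inv_mul_perm, one_mul, mul_one]

lemma eq_of_mul_perm_mul_eq (hc : c ∈ Bminus n) (hc' : c' ∈ Bminus n)
    (hg : g ∈ unitriangular ℝ u) (hG : G ∈ unitriangular ℝ u)
    (h : c * perm u * g = c' * perm u * G) : g = G := by
  have hconj := right_eq_of_Bminus_mul_N_eq hc hc' (perm_conj_mem_N hg) (perm_conj_mem_N hG) (by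
    simp only [← mul_assoc, h])
  rw [← perm_inv_conj_perm_conj u g, hconj, perm_inv_conj_perm_conj]

/-- Coordinates on the fiber of `π_u` through `x`: a factorization `x = c u g` as in `CellFactor`
together with the factors of `g = l z`, for which `x_u = c u l`. -/
structure FiberFactor (u : Equiv.Perm (Fin n)) (xu x c g l z : Mat n) : Prop
    extends CellFactor u x c g where
  left_mem : l ∈ unitriangular ℝ u ⊓ unitriangular ℝ OrderDual.toDual
  right_mem : z ∈ unitriangular ℝ u ⊓ unitriangular ℝ id
  upper_eq : g = l * z
  base_eq : xu = c * perm u * l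
  base_mem : xu ∈ N n

namespace CellFactor

lemma piProj_eq (h : CellFactor u x c g) (hl : l ∈ unitriangular ℝ OrderDual.toDual)
    (hz : z ∈ unitriangular ℝ id) (hg : g = l * z) (hb : c * perm u * l ∈ N n) :
    piProj u x = c * perm u * l := by
  have hx : x * perm u⁻¹ = c * (perm u * g * perm u⁻¹) := by
    rw [h.eq_mul]
    simp only [mul_assoc]
  have hl' : perm u * l = c⁻¹ * (c * perm u * l) := by
    rw [mul_assoc c, nonsing_inv_mul_cancel_left _ _ (mem_Bminus_iff.1 h.lower).2]
  rw [piProj, hx, gaussPlus_mul h.lower (perm_conj_mem_N h.upper), perm_inv_conj_perm_conj, hg,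
    gaussMinus_mul (mem_Nminus_iff.2 hl) (mem_N_iff.2 hz), hl',
    gaussPlus_mul (inv_mem_Bminus h.lower) hb]

lemma exists_fiberFactor (h : CellFactor u x c g) (hx : x ∈ N n) :
    ∃ l z, FiberFactor u (piProj u x) x c g l z := by
  obtain ⟨l, hl, z, hz, hg⟩ := unitriangular.exists_lower_mul_upper h.upper
  have hbase : c * perm u * l = x * z⁻¹ := by
    rw [h.eq_mul, hg, mul_assoc _ (l * z), mul_nonsing_inv_cancel_right _ _
      (unitriangular.isUnit_det hz.2)]
  have hmem : c * perm u * l ∈ N n := by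
    rw [hbase, mem_N_iff]
    exact mul_mem (mem_N_iff.1 hx) (unitriangular.inv_mem hz.2)
  have hpi := h.piProj_eq hl.2 hz.2 hg hmem
  exact ⟨l, z, { h with
    left_mem := hl
    right_mem := hz
    upper_eq := hg
    base_eq := hpi
    base_mem := hpi ▸ hmem }⟩

end CellFactor

lemma exists_fiberFactor (hx : x ∈ fiber u xu) : ∃ c g l z, FiberFactor u xu x c g l z := by
  obtain ⟨hgeq, rfl⟩ := hx
  obtain ⟨c, g, h⟩ := exists_cellFactor hgeq
  obtain ⟨v, -, hxY, -⟩ := hgeq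
  obtain ⟨l, z, hlz⟩ := h.exists_fiberFactor (mem_N_of_mem_Y hxY)
  exact ⟨c, g, l, z, hlz⟩

lemma inv_mul_eq_of_mul_eq (hG : G ∈ unitriangular ℝ u) (hw : w ∈ unitriangular ℝ u)
    (h : G * m = l * w) : G⁻¹ * l = m * w⁻¹ := by
  rw [← mul_nonsing_inv_cancel_right _ l (unitriangular.isUnit_det hw), ← h, mul_assoc G,
    nonsing_inv_mul_cancel_left _ _ (unitriangular.isUnit_det hG)]

namespace FiberFactor

lemma eq_base_mul (h : FiberFactor u xu x c g l z) : x = xu * z := by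
  rw [h.eq_mul, h.upper_eq, h.base_eq, ← mul_assoc]

lemma mem_unitriangular (h : FiberFactor u xu x c g l z) : x ∈ unitriangular ℝ id := by
  rw [h.eq_base_mul]
  exact mul_mem (mem_N_iff.1 h.base_mem) h.right_mem.2

lemma eq_base_of_lower (h : FiberFactor u xu x c g l z) (hg : ∀ i j, i < j → g i j = 0) :
    x = xu := by
  have hg' : g ∈ Nminus n := ⟨hg, unitriangular.diag h.upper⟩
  have hz := right_eq_of_Bminus_mul_N_eq (Nminus_subset_Bminus hg')
    (Nminus_subset_Bminus (mem_Nminus_iff.2 h.left_mem.2)) (mem_N_iff.2 (one_mem _))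
    (mem_N_iff.2 h.right_mem.2) (by rw [mul_one, h.upper_eq])
  rw [h.eq_base_mul, ← hz, mul_one]

lemma upper_eq_of_self (h : FiberFactor u xu xu c g l z) : g = l :=
  eq_of_mul_perm_mul_eq h.lower h.lower h.upper h.left_mem.1 (h.eq_mul.symm.trans h.base_eq)

lemma mul_eq_of_upper_mul_eq (h : FiberFactor u xu x c g l z) (hX : X = c' * perm u * G)
    (hGm : G * m = l * w) : X * m = c' * c⁻¹ * (xu * w) := by
  rw [hX, mul_assoc, hGm, h.base_eq]
  simp only [mul_assoc]
  rw [nonsing_inv_mul_cancel_left _ _ (mem_Bminus_iff.1 h.lower).2]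

lemma base_mul_mem_N (h : FiberFactor u xu x c g l z) (hw : w ∈ NOf u) : xu * w ∈ N n :=
  mem_N_iff.2 (mul_mem (mem_N_iff.1 h.base_mem) (mem_NOf_iff.1 hw).2)

lemma isShift_iff_exists (h : FiberFactor u xu x c g l z) (hc' : c' ∈ Bminus n)
    (hG : G ∈ unitriangular ℝ u) (hX : X = c' * perm u * G) :
    IsShift u xu X m ↔ m ∈ NminusOf u ∧ ∃ w ∈ NOf u, G * m = l * w := by
  refine and_congr_right fun hm => ⟨?_, ?_⟩
  · rintro ⟨hmem, w, hw, hplus⟩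
    refine ⟨w, hw, ?_⟩
    obtain ⟨e, he, -, hXm⟩ := exists_eq_mul_gaussPlus hmem
    refine eq_of_mul_perm_mul_eq hc' (mul_mem_Bminus he h.lower)
      (mul_mem hG (mem_NminusOf_iff.1 hm).1) (mul_mem h.left_mem.1 (mem_NOf_iff.1 hw).1) ?_
    rw [hplus, hX, h.base_eq] at hXm
    simpa only [mul_assoc] using hXm
  · rintro ⟨w, hw, hGm⟩
    have hlower := mul_mem_Bminus hc' (inv_mem_Bminus h.lower)
    rw [h.mul_eq_of_upper_mul_eq hX hGm]
    exact ⟨mul_mem_G0 hlower (h.base_mul_mem_N hw), w, hw,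
      gaussPlus_mul hlower (h.base_mul_mem_N hw)⟩

lemma isShift_iff (h : FiberFactor u xu x c g l z) (hc' : c' ∈ Bminus n)
    (hG : G ∈ unitriangular ℝ u) (hX : X = c' * perm u * G) :
    IsShift u xu X m ↔ m = gaussMinus (G⁻¹ * l) := by
  rw [h.isShift_iff_exists hc' hG hX]
  constructor
  · rintro ⟨hm, w, hw, hGm⟩
    rw [mem_NOf_iff] at hw
    rw [inv_mul_eq_of_mul_eq hG hw.1 hGm,
      gaussMinus_mul hm.2 (mem_N_iff.2 (unitriangular.inv_mem hw.2))]
  · rintro rfl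
    obtain ⟨m, hm, w, hw, hmw⟩ := unitriangular.exists_lower_mul_upper
      (mul_mem (unitriangular.inv_mem hG) h.left_mem.1)
    rw [hmw, gaussMinus_mul (mem_Nminus_iff.2 hm.2) (mem_N_iff.2 hw.2)]
    refine ⟨mem_NminusOf_iff.2 hm, w⁻¹,
      mem_NOf_iff.2 ⟨unitriangular.inv_mem hw.1, unitriangular.inv_mem hw.2⟩, ?_⟩
    rw [← mul_nonsing_inv_cancel_left _ l (unitriangular.isUnit_det hG), hmw, mul_assoc G,
      mul_nonsing_inv_cancel_right _ _ (unitriangular.isUnit_det hw.1)]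

lemma rho_eq (h : FiberFactor u xu x c g l z) (hc' : c' ∈ Bminus n)
    (hG : G ∈ unitriangular ℝ u) (hX : X = c' * perm u * G) :
    rho u xu X = xu * (gaussPlus (G⁻¹ * l))⁻¹ := by
  have hex : ∃ m, IsShift u xu X m := ⟨_, (h.isShift_iff hc' hG hX).2 rfl⟩
  obtain ⟨hm, w, hw, hGm⟩ := (h.isShift_iff_exists hc' hG hX).1 hex.choose_spec
  have hw' := mem_NOf_iff.1 hw
  rw [rho, dif_pos hex, h.mul_eq_of_upper_mul_eq hX hGm,
    gaussPlus_mul (mul_mem_Bminus hc' (inv_mem_Bminus h.lower)) (h.base_mul_mem_N hw),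
    inv_mul_eq_of_mul_eq hG hw'.1 hGm, gaussPlus_mul (Nminus_subset_Bminus hm.2)
      (mem_N_iff.2 (unitriangular.inv_mem hw'.2)),
    nonsing_inv_nonsing_inv _ (unitriangular.isUnit_det hw'.1)]

lemma existsUnique_isShift_scale (h : FiberFactor u xu x c g l z) (hτ : 0 < τ) :
    ∃! m, IsShift u xu (scale τ x) m := by
  obtain ⟨c', hc', hX⟩ := exists_scale_mul_perm_mul hτ h.lower u g
  have hiff {m : Mat n} := h.isShift_iff (m := m) hc' (scale_mem_unitriangular hτ h.upper)
    (h.eq_mul ▸ hX)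
  exact ⟨_, hiff.2 rfl, fun _ => hiff.1⟩

lemma rho_scale (h : FiberFactor u xu x c g l z) (hτ : 0 < τ) :
    rho u xu (scale τ x) = xu * (gaussPlus (scale τ g⁻¹ * l))⁻¹ := by
  obtain ⟨c', hc', hX⟩ := exists_scale_mul_perm_mul hτ h.lower u g
  rw [h.rho_eq hc' (scale_mem_unitriangular hτ h.upper) (h.eq_mul ▸ hX),
    scale_inv hτ (unitriangular.isUnit_det h.upper)]

end FiberFactor

lemma mem_fiber_self (hxu : xu ∈ Ycell u) : xu ∈ fiber u xu := by
  have hgeq : xu ∈ Ygeq u := ⟨u, subset_closure, hxu⟩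
  obtain ⟨c, g, h⟩ := exists_cellFactor hgeq
  obtain ⟨l, z, hlz⟩ := h.exists_fiberFactor (mem_N_of_mem_Y hxu.1)
  exact ⟨hgeq, (hlz.eq_base_of_lower fun i j => h.apply_eq_zero_of_mem_bruhatCell hxu.2).symm⟩

end Fiber

section GaussDerivative

open scoped Matrix.Norms.Operator

variable {n p : ℕ} {t : ℝ} {x a c A : Mat n} {F P : ℝ → Mat n} {F' P' : Mat n}

lemma flagMinor_castLE_of_mem_N (ha : a ∈ N n) (hp : p ≤ n) :
    flagMinor hp (Fin.castLE hp) a = 1 :=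
  unitriangular.det_eq_one
    (unitriangular.submatrix (Fin.castLE_injective hp) (mem_N_iff.1 ha))

lemma mem_G0_iff : x ∈ G0 n ↔ ∀ p (hp : p ≤ n), flagMinor hp (Fin.castLE hp) x ≠ 0 := by
  constructor
  · intro hx p hp
    obtain ⟨c, hc, ha, heq⟩ := exists_eq_mul_gaussPlus hx
    rw [heq, flagMinor_lower_mul hp _ (mem_Bminus_iff.1 hc).1]
    refine mul_ne_zero (flagMinor_castLE_ne_zero_of_mem_Bminus hp hc) ?_
    rw [flagMinor_castLE_of_mem_N ha]
    exact one_ne_zero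
  · intro hx
    obtain ⟨c, hc, a, ha, rfl⟩ := exists_Bminus_mul_N hx
    exact mul_mem_G0 hc ha

lemma isOpen_G0 : IsOpen (G0 n) := by
  have hinter : G0 n = ⋂ p : Fin (n + 1), flagMinor p.is_le (Fin.castLE p.is_le) ⁻¹' {0}ᶜ := by
    ext x
    rw [mem_G0_iff, Set.mem_iInter, Fin.forall_iff]
    simp only [Nat.lt_succ_iff]
    rfl
  rw [hinter]
  exact isOpen_iInter_of_finite fun p =>
    isOpen_compl_singleton.preimage (continuous_flagMinor p.is_le _)

lemma flagMinor_update_last_of_mem_N (ha : a ∈ N n) (i j : Fin n) :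
    flagMinor i.is_lt (Function.update (Fin.castLE i.is_lt) (Fin.last i) j) a = a i j := by
  rw [mem_N_iff] at ha
  have hlower (d : Fin (i + 1)) (k : Fin n) (hk : k < Fin.castLE i.is_lt d) :
      k ∈ Set.range (Fin.castLE i.is_lt) :=
    ⟨⟨k, (Fin.lt_def.1 hk).trans d.is_lt⟩, rfl⟩
  have hinv := unitriangular.inv_mem ha
  rw [flagMinor, unitriangular.det_submatrix_update ha (Fin.castLE_injective _) hlower,
    sum_eq_single_of_mem (Fin.last i) (mem_univ _), unitriangular.diag hinv, one_mul]
  · rfl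
  · intro d _ hd
    rw [hinv (Fin.castLE _ (Fin.last i)) (Fin.castLE _ d) d.le_last, one_apply_ne, zero_mul]
    exact (Fin.castLE_injective _).ne hd.symm

lemma gaussPlus_apply (hx : x ∈ G0 n) (i j : Fin n) : gaussPlus x i j =
    flagMinor i.is_lt (Function.update (Fin.castLE i.is_lt) (Fin.last i) j) x
      / flagMinor i.is_lt (Fin.castLE i.is_lt) x := by
  obtain ⟨c, hc, ha, heq⟩ := exists_eq_mul_gaussPlus hx
  have hminor := mem_G0_iff.1 hx _ i.is_lt
  rw [eq_div_iff hminor]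
  nth_rw 2 3 [heq]
  simp only [flagMinor_lower_mul _ _ (mem_Bminus_iff.1 hc).1]
  rw [flagMinor_castLE_of_mem_N ha, flagMinor_update_last_of_mem_N ha, mul_one, mul_comm]

lemma differentiable_flagMinor (hp : p ≤ n) (s : Fin p → Fin n) :
    Differentiable ℝ (flagMinor hp s) := by
  have (i j : Fin n) : Differentiable ℝ fun x : Mat n => x i j :=
    differentiable_pi.1 (differentiable_pi.1 differentiable_id i) j
  unfold flagMinor
  simp only [det_apply', submatrix_apply]
  fun_prop

lemma differentiableAt_gaussPlus (hx : x ∈ G0 n) : DifferentiableAt ℝ gaussPlus x := by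
  refine differentiableAt_pi.2 fun i => differentiableAt_pi.2 fun j => ?_
  refine DifferentiableAt.congr_of_eventuallyEq ?_
    ((isOpen_G0.eventually_mem hx).mono fun y hy => gaussPlus_apply hy i j)
  have hnum := differentiable_flagMinor i.is_lt
    (Function.update (Fin.castLE i.is_lt) (Fin.last i) j) x
  exact hnum.mul ((differentiable_flagMinor i.is_lt _ x).fun_inv (mem_G0_iff.1 hx _ i.is_lt))

lemma hasDerivAt_nonsing_inv {A : ℝ → Mat n} {A' : Mat n} (hA : HasDerivAt A A' t)
    (hu : IsUnit (A t)) : HasDerivAt (fun s => (A s)⁻¹) (-((A t)⁻¹ * A' * (A t)⁻¹)) t := by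
  simp only [nonsing_inv_eq_ringInverse]
  obtain ⟨v, hv⟩ := hu
  have hinv := hasFDerivAt_ringInverse (𝕜 := ℝ) v
  rw [hv] at hinv
  refine (hinv.comp_hasDerivAt t hA).congr_deriv ?_
  rw [← hv, Ring.inverse_unit]
  rfl

/-- The strictly upper triangular part: the projection of the Lie algebra of all matrices onto
that of `N`, with kernel the Lie algebra of `B₋`. -/
def strictUpper (A : Mat n) : Mat n :=
  of fun i j => if i < j then A i j else 0

lemma strictUpper_apply (A : Mat n) (i j : Fin n) :
    strictUpper A i j = if i < j then A i j else 0 := rfl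

lemma strictUpper_add (A B : Mat n) : strictUpper (A + B) = strictUpper A + strictUpper B := by
  ext i j
  simp only [strictUpper_apply, Matrix.add_apply, ite_add_ite, add_zero]

lemma strictUpper_neg (A : Mat n) : strictUpper (-A) = -strictUpper A := by
  ext i j
  simp only [strictUpper_apply, Matrix.neg_apply, neg_ite, neg_zero]

lemma strictUpper_of_isLowerTriangular (hA : A.IsLowerTriangular) : strictUpper A = 0 := by
  ext i j
  exact ite_eq_right_iff.2 fun hij => hA hij

lemma strictUpper_eq_self (hA : ∀ i j, j ≤ i → A i j = 0) : strictUpper A = A := by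
  ext i j
  exact ite_eq_left_iff.2 fun hij => (hA i j (not_lt.1 hij)).symm

lemma strictUpper_strictUpper_mul (A : Mat n) (ha : a.IsUpperTriangular) :
    strictUpper (strictUpper A * a) = strictUpper A * a := by
  refine strictUpper_eq_self fun i j hij => ?_
  rw [Matrix.mul_apply]
  refine sum_eq_zero fun k _ => ?_
  obtain hk | hk := le_or_gt k i
  · rw [strictUpper_apply, if_neg hk.not_gt, zero_mul]
  · rw [ha (hij.trans_lt hk), mul_zero]

lemma hasDerivAt_entry (hF : HasDerivAt F F' t) (i j : Fin n) :
    HasDerivAt (fun s => F s i j) (F' i j) t :=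
  hasDerivAt_pi.1 (hasDerivAt_pi.1 hF i) j

lemma deriv_entry_eq_zero (hF : HasDerivAt F F' t) {i j : Fin n} {r : ℝ}
    (hconst : ∀ᶠ s in nhds t, F s i j = r) : F' i j = 0 :=
  (hasDerivAt_entry hF i j).unique ((hasDerivAt_const t r).congr_of_eventuallyEq hconst)

lemma deriv_unipotent_factor (hF : HasDerivAt F F' t) (hP : HasDerivAt P P' t)
    (hPN : ∀ᶠ s in nhds t, P s ∈ N n) (hFP : ∀ᶠ s in nhds t, F s * (P s)⁻¹ ∈ Bminus n)
    (hc : c ∈ Bminus n) (hFt : F t = c * P t) :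
    P' = strictUpper (c⁻¹ * F' * (P t)⁻¹) * P t := by
  have hPt := mem_N_iff.1 hPN.self_of_nhds
  have hunit := unitriangular.isUnit_det hPt
  have hP' : strictUpper P' = P' := strictUpper_eq_self fun i j hij =>
    deriv_entry_eq_zero hP (hPN.mono fun s hs => mem_N_iff.1 hs i j hij)
  have hC := hF.mul (hasDerivAt_nonsing_inv hP ((isUnit_iff_isUnit_det _).2 hunit))
  set C' := F' * (P t)⁻¹ + F t * -((P t)⁻¹ * P' * (P t)⁻¹) with hC'
  have hlower : C'.IsLowerTriangular := fun i j hij =>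
    deriv_entry_eq_zero hC (hFP.mono fun s hs => hs.1 _ _ hij)
  have hsplit : c⁻¹ * F' * (P t)⁻¹ = c⁻¹ * C' + P' * (P t)⁻¹ := by
    rw [hC', hFt, mul_add, mul_neg, mul_neg]
    simp only [mul_assoc, nonsing_inv_mul_cancel_left _ _ (mem_Bminus_iff.1 hc).2,
      mul_nonsing_inv_cancel_left _ _ hunit, neg_add_cancel_right]
  rw [hsplit, strictUpper_add, strictUpper_of_isLowerTriangular
    ((mem_Bminus_iff.1 (inv_mem_Bminus hc)).1.mul hlower), zero_add, ← hP',
    strictUpper_strictUpper_mul _ (unitriangular.blockTriangular (unitriangular.inv_mem hPt)),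
    nonsing_inv_mul_cancel_right _ _ hunit]

lemma mul_inv_gaussPlus_mem_Bminus (hx : x ∈ G0 n) :
    x * (gaussPlus x)⁻¹ ∈ Bminus n := by
  obtain ⟨c, hc, ha, heq⟩ := exists_eq_mul_gaussPlus hx
  nth_rw 1 [heq]
  rwa [mul_nonsing_inv_cancel_right _ _ (unitriangular.isUnit_det (mem_N_iff.1 ha))]

lemma gaussPlus_mem_N (hx : x ∈ G0 n) : gaussPlus x ∈ N n := by
  obtain ⟨-, -, ha, -⟩ := exists_eq_mul_gaussPlus hx
  exact ha

lemma hasDerivAt_gaussPlus (hF : HasDerivAt F F' t) (hc : c ∈ Bminus n) (ha : a ∈ N n)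
    (hFt : F t = c * a) :
    HasDerivAt (fun s => gaussPlus (F s)) (strictUpper (c⁻¹ * F' * a⁻¹) * a) t := by
  have hG0 : ∀ᶠ s in nhds t, F s ∈ G0 n :=
    hF.continuousAt.eventually_mem (isOpen_G0.mem_nhds (hFt ▸ mul_mem_G0 hc ha))
  have hFt' : gaussPlus (F t) = a := by rw [hFt, gaussPlus_mul hc ha]
  obtain ⟨P', hP⟩ : ∃ P', HasDerivAt (fun s => gaussPlus (F s)) P' t :=
    ⟨_, ((differentiableAt_gaussPlus hG0.self_of_nhds).comp t hF.differentiableAt).hasDerivAt⟩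
  have hP' := deriv_unipotent_factor hF hP (hG0.mono fun s hs => gaussPlus_mem_N hs)
    (hG0.mono fun s hs => mul_inv_gaussPlus_mem_Bminus hs) hc (hFt'.symm ▸ hFt)
  rw [hFt'] at hP'
  exact hP' ▸ hP

lemma hasDerivAt_scale (g : Mat n) :
    HasDerivAt (fun τ => scale τ g) (weight n * g - g * weight n) 1 := by
  refine hasDerivAt_pi.2 fun i => hasDerivAt_pi.2 fun j => ?_
  have hpow : HasDerivAt (fun τ : ℝ => τ ^ ((j : ℤ) - i) * g i j) _ 1 :=
    (hasDerivAt_zpow _ _ (Or.inl one_ne_zero)).mul_const _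
  refine (hpow.congr_of_eventuallyEq ?_).congr_deriv ?_
  · filter_upwards [lt_mem_nhds zero_lt_one] with τ hτ using scale_apply hτ g i j
  · rw [Matrix.sub_apply, weight, diagonal_mul, mul_diagonal, _root_.one_zpow]
    push_cast
    ring

namespace FiberFactor

variable {u : Equiv.Perm (Fin n)} {xu g l z : Mat n}

lemma inv_upper_mul (h : FiberFactor u xu x c g l z) : g⁻¹ * l = z⁻¹ := by
  rw [h.upper_eq, Matrix.mul_inv_rev, mul_assoc,
    nonsing_inv_mul _ (unitriangular.isUnit_det h.left_mem.1), mul_one]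

lemma hasDerivAt_gaussPlus_scale (h : FiberFactor u xu x c g l z) :
    HasDerivAt (fun τ => gaussPlus (scale τ g⁻¹ * l))
      (-strictUpper (g⁻¹ * weight n * g) * z⁻¹) 1 := by
  have hz := h.right_mem.2
  have hweight : (weight n).IsLowerTriangular := blockTriangular_diagonal _
  have hpath := (hasDerivAt_scale g⁻¹).mul_const l
  have hcancel : (weight n * g⁻¹ - g⁻¹ * weight n) * l * z = weight n - g⁻¹ * weight n * g := by
    rw [mul_assoc, ← h.upper_eq, sub_mul, mul_assoc (weight n),
      nonsing_inv_mul _ (unitriangular.isUnit_det h.upper), mul_one]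
  refine (hasDerivAt_gaussPlus hpath one_mem_Bminus (mem_N_iff.2 (unitriangular.inv_mem hz))
    (by rw [scale_one, h.inv_upper_mul, one_mul])).congr_deriv ?_
  rw [inv_one, one_mul, nonsing_inv_nonsing_inv _ (unitriangular.isUnit_det hz), hcancel,
    sub_eq_add_neg, strictUpper_add, strictUpper_neg,
    strictUpper_of_isLowerTriangular hweight, zero_add]

lemma hasDerivAt_rho (h : FiberFactor u xu x c g l z) :
    HasDerivAt (fun τ => rho u xu (scale τ x)) (x * strictUpper (g⁻¹ * weight n * g)) 1 := by
  have hz := unitriangular.isUnit_det h.right_mem.2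
  have hone : gaussPlus (scale 1 g⁻¹ * l) = z⁻¹ := by
    rw [scale_one, h.inv_upper_mul, ← one_mul z⁻¹, gaussPlus_mul one_mem_Bminus
      (mem_N_iff.2 (unitriangular.inv_mem h.right_mem.2)), one_mul]
  have hinv := hasDerivAt_nonsing_inv h.hasDerivAt_gaussPlus_scale
    (by rw [hone, isUnit_nonsing_inv_iff, isUnit_iff_isUnit_det]; exact hz)
  refine ((hinv.const_mul xu).congr_of_eventuallyEq ?_).congr_deriv ?_
  · filter_upwards [lt_mem_nhds zero_lt_one] with τ hτ using h.rho_scale hτ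
  · rw [hone, nonsing_inv_nonsing_inv _ hz, h.eq_base_mul]
    simp only [neg_mul, mul_neg, neg_neg, mul_assoc, nonsing_inv_mul _ hz, mul_one]

lemma psi_eq (h : FiberFactor u xu x c g l z) :
    psi u xu x = x * strictUpper (g⁻¹ * weight n * g) :=
  h.hasDerivAt_rho.deriv

lemma differentiableAt_rho (h : FiberFactor u xu x c g l z) :
    DifferentiableAt ℝ (fun τ => rho u xu (scale τ x)) 1 :=
  h.hasDerivAt_rho.differentiableAt

end FiberFactor

end GaussDerivative

section StrAlongPsi

variable {n : ℕ} {u : Equiv.Perm (Fin n)} {xu x c g l z : Mat n}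

lemma lineDeriv_str (x v : Mat n) : lineDeriv ℝ str x v = str v := by
  have h (t : ℝ) : str (x + t • v) = str x + t * str v := by
    simp only [str, Finset.mul_sum, ← Finset.sum_add_distrib]
    refine Finset.sum_congr rfl fun i _ => ?_
    split_ifs
    · rw [Matrix.add_apply, Matrix.smul_apply, smul_eq_mul]
    · rw [mul_zero, add_zero]
  refine HasLineDerivAt.lineDeriv ?_
  rw [HasLineDerivAt]
  simp only [h]
  simpa using ((hasDerivAt_id (0 : ℝ)).mul_const (str v)).const_add (str x)

lemma str_mul_strictUpper (hx : x ∈ unitriangular ℝ id) (A : Mat n) :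
    str (x * strictUpper A) = str A := by
  refine sum_congr rfl fun i _ => dite_congr rfl (fun hi => ?_) fun _ => rfl
  have hlt : i < ⟨i + 1, hi⟩ := Nat.lt_succ_self _
  rw [Matrix.mul_apply, sum_eq_single_of_mem i (mem_univ i), unitriangular.diag hx, one_mul,
    strictUpper_apply, if_pos hlt]
  intro k _ hk
  obtain hk | hk := hk.lt_or_gt
  · rw [unitriangular.blockTriangular hx hk, zero_mul]
  · have hle : ⟨i + 1, hi⟩ ≤ k := Nat.succ_le_of_lt hk
    rw [strictUpper_apply, if_neg hle.not_gt, mul_zero]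

namespace FiberFactor

lemma psi_base (h : FiberFactor u xu xu c g l z) : psi u xu xu = 0 := by
  have hl := h.left_mem.2
  rw [h.psi_eq, h.upper_eq_of_self, strictUpper_of_isLowerTriangular, mul_zero]
  exact ((unitriangular.blockTriangular (unitriangular.inv_mem hl)).mul
    (blockTriangular_diagonal _)).mul (unitriangular.blockTriangular hl)

lemma lineDeriv_str_psi_pos (h : FiberFactor u xu x c g l z) (hne : x ≠ xu) :
    0 < lineDeriv ℝ str x (psi u xu x) := by
  obtain ⟨i, j, hij, hg⟩ : ∃ i j, i < j ∧ g i j ≠ 0 := by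
    by_contra! hg
    exact hne (h.eq_base_of_lower hg)
  rw [lineDeriv_str, h.psi_eq, str_mul_strictUpper h.mem_unitriangular]
  exact h.str_inv_mul_weight_mul_pos hij hg

end FiberFactor

end StrAlongPsi

end TNNLink

end

theorem lemma5p4 {n : ℕ} (u : Equiv.Perm (Fin n)) (xu : TNNLink.Mat n)
    (hxu : xu ∈ TNNLink.Ycell u) :
    -- the vector field is well defined on the fiber
    (∀ x ∈ TNNLink.fiber u xu,
      (∀ τ : ℝ, 0 < τ →
        TNNLink.scale τ x ∈ TNNLink.Ygeq u ∧
        ∃! m, TNNLink.IsShift u xu (TNNLink.scale τ x) m) ∧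
      DifferentiableAt ℝ (fun τ : ℝ => TNNLink.rho u xu (TNNLink.scale τ x)) 1) ∧
    -- it vanishes at `xu` and nowhere else on the fiber
    {x | x ∈ TNNLink.fiber u xu ∧ TNNLink.psi u xu x = 0} = {xu} ∧
    -- the derivative of `str` along it is positive at every other point
    (∀ x ∈ TNNLink.fiber u xu, x ≠ xu →
      0 < lineDeriv ℝ TNNLink.str x (TNNLink.psi u xu x)) := by
  have hpos : ∀ x ∈ TNNLink.fiber u xu, x ≠ xu →
      0 < lineDeriv ℝ TNNLink.str x (TNNLink.psi u xu x) := fun x hx hne => by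
    obtain ⟨c, g, l, z, h⟩ := TNNLink.exists_fiberFactor hx
    exact h.lineDeriv_str_psi_pos hne
  refine ⟨fun x hx => ?_, Set.Subset.antisymm ?_ ?_, hpos⟩
  · obtain ⟨c, g, l, z, h⟩ := TNNLink.exists_fiberFactor hx
    exact ⟨fun τ hτ => ⟨TNNLink.scale_mem_Ygeq hτ hx.1, h.existsUnique_isShift_scale hτ⟩,
      h.differentiableAt_rho⟩
  · rintro x ⟨hx, hpsi⟩
    by_contra hne
    have hlt := hpos x hx hne
    rw [hpsi, lineDeriv_zero] at hlt
    exact hlt.false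
  · have hbase := TNNLink.mem_fiber_self hxu
    obtain ⟨c, g, l, z, h⟩ := TNNLink.exists_fiberFactor hbase
    exact Set.singleton_subset_iff.2 ⟨hbase, h.psi_base⟩
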